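/- Let $M$ be an oriented 1-cusped 3-manifold (for instance a 1-cusped hyperbolic one) with an ideal triangulation $\mathcal T$ having tetrahedra $\Delta_1,\dots,\Delta_N$ and (oriented) edges $e_1,\dots,e_N$, and let $\alpha:\pi_1(M)\twoheadrightarrow\mathbb Z$ be an epimorphism. For chosen quad types let $z=(z_1,\dots,z_N)\in(\mathbb C\setminus\{0,1\})^N$ be a solution of the gluing equations and of the completeness equations of all peripheral curves (for instance the geometric solution), and write $z_j'=\frac1{1-z_j}$, $z_j''=1-\frac1{z_j}$, $\zeta_j=\frac1{z_j}$, $\zeta'_j=\frac1{1-z_j}$, $\zeta''_j=\frac1{z_j(z_j-1)}$. Let $\mathbf G^\square_{ij}$ be the number of edges of $\Delta_j$ with parameter $z_j^\square$ that are incident to $e_i$, and for a peripheral curve $\gamma$ let $\mathbf C_\gamma^\square\in\mathbb Z^N$ be the row vectors of exponents of $z^\square$ in the completeness equation of $\gamma$. A combinatorial flattening consists of $f,f',f''\in\mathbb Z^N$ with $f+f'+f''=(1,\dots,1)^T$, $\mathbf Gf+\mathbf G'f'+\mathbf G''f''=(2,\dots,2)^T$ and $\mathbf C_\gamma f+\mathbf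 C'_\gamma f'+\mathbf C''_\gamma f''=0$ for all peripheral curves $\gamma$. The 1-loop invariant with respect to $\gamma$ is $$\tau_\gamma^{\mathrm{CS}}(\mathcal T)=\pm\frac12\,\frac{\det\big(\widehat{\mathbf G}\,\mathrm{diag}(\zeta)+\widehat{\mathbf G}'\,\mathrm{diag}(\zeta')+\widehat{\mathbf G}''\,\mathrm{diag}(\zeta'')\big)}{\prod_j\zeta_j^{f_j}{\zeta'_j}^{f'_j}{\zeta''_j}^{f''_j}},$$ where $\widehat{\mathbf G}^\square$ arises from $\mathbf G^\square$ by replacing one row (the same row for all $\square$) by $\mathbf C_\gamma^\square$. Truncate the tetrahedra and let $\sigma$ be a $\{\pm1\}$-valued cocycle on the edges (short edges) of the resulting triangulation of the peripheral torus. A $\sigma$-Ptolemy assignment is a map $c$ from the oriented edges of $\mathcal T$ to $\mathbb C^*$ with $c(-e)=-c(e)$ satisfying, for each tetrahedron $[v_0,v_1,v_2,v_3]$ (vertices ordered compatibly with the orientation), the $\sigma$-Ptolemy equation $$c(l_{02})c(l_{13})-\frac{\sigma(s_{031})\sigma(s_{302})}{\sigma(s_{312})\sigma(s_{021})}c(l_{03})c(l_{12})-\frac{\sigma(s_{013})\sigma(s_{102})}{\sigma(s_{132})\sigma(s_{023})}c(l_{01})c(l_{23})=0,$$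 where $l_{ij}$ is the edge from $v_i$ to $v_j$ and $s_{ijk}$ is the short edge from $l_{ij}$ to $l_{jk}$. It corresponds to $z$ if for each tetrahedron the shape parameter at $l_{13}$ is $-\frac{\sigma(s_{103})\sigma(s_{321})}{\sigma(s_{032})\sigma(s_{210})}\frac{c(l_{01})c(l_{23})}{c(l_{03})c(l_{12})}$. Let $c$ be a $\sigma$-Ptolemy assignment corresponding to $z$. Let $\widetilde M$ be the infinite cyclic cover of $M$ determined by $\alpha$, with a generator $g$ of its deck transformation group. Choose a fundamental domain, i.e. a lift $\widetilde\Delta_j$ of each $\Delta_j$, and lifts $\widetilde e_1,\dots,\widetilde e_N$ of $e_1,\dots,e_N$ that are edges of $\widetilde\Delta_1,\dots,\widetilde\Delta_N$; let $\widetilde e_{N+1},\dots,\widetilde e_{N+L}$ be the other edges of $\widetilde\Delta_1,\dots,\widetilde\Delta_N$, and write $\widetilde e_i=g^{k(i)}\cdot\widetilde e_{j(i)}$ with $1\le j(i)\le N$ for $i>N$. In variables $c_1,\dots,c_{N+L}$ attached to the edges $\widetilde e_i$ let $p_i^\sigma$ be the left-hand side of the $\sigma$-Ptolemy equation of $\widetilde\Delta_i$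 for $1\le i\le N$, and $p_i^\sigma=c_i-t^{-k(i)}c_{j(i)}$ for $N<i\le N+L$. The Jacobian below is evaluated at the point given by $c$, i.e. $c_i=c(e_i)$ for $i\le N$ and $c_i=c_{j(i)}$ for $i>N$. Let $\lambda$ be a peripheral curve (an oriented, homotopically non-trivial simple closed curve in the peripheral torus) with $\alpha(\lambda)=0$, and let $m\ge0$ be the integer with $\alpha(\pi_1(\partial\overline M))=m\mathbb Z$. Then $$m\cdot\tau_\lambda^{\mathrm{CS}}(\mathcal T)=\pm\frac1{c_1\cdots c_N}\left.\frac{d}{dt}\right|_{t=1}\det\left(\frac{\partial p_i^\sigma}{\partial c_j}\right)_{1\le i,j\le N+L}.$$ In particular, if some peripheral curve $\mu$ has $\alpha(\mu)=1$ (as for knot complements in $S^3$ and once-punctured torus bundles), then $$\tau_\lambda^{\mathrm{CS}}(\mathcal T)=\pm\frac1{c_1\cdots c_N}\left.\frac{d}{dt}\right|_{t=1}\det\left(\frac{\partial p_i^\sigma}{\partial c_j}\right)_{1\le i,j\le N+L}.$$ -/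

import Mathlib

open Relation

/-- A combinatorial oriented ideal triangulation with one cusp, with tetrahedra `Δ_j`, `j : Fin N`.
The vertices of every tetrahedron are labelled by `Fin 4` (compatibly with the orientation), and its
faces are labelled by the opposite vertex. The face `f` of `Δ_j` is glued to the face `glue j f f` of
`Δ_(nbr j f)`; on the vertices `v ≠ f` of that face the gluing map is `v ↦ glue j f v`. -/
structure IdealTriangulation (N : ℕ) where
  nbr : Fin N → Fin 4 → Fin N
  glue : Fin N → Fin 4 → Equiv.Perm (Fin 4)
  nbr_nbr : ∀ j f, nbr (nbr j f) (glue j f f) = j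
  glue_glue : ∀ j f, glue (nbr j f) (glue j f f) = (glue j f)⁻¹
  /-- no face is glued to itself -/
  no_self : ∀ j f, ¬ (nbr j f = j ∧ glue j f f = f)
  /-- all gluing maps reverse the orientation of the faces, so that the manifold is oriented -/
  oriented : ∀ j f, Equiv.Perm.sign (glue j f) = -1
  /-- The triangles cut off at the vertices `(j, v)` form a connected surface, that is, there is only
  one cusp. (This surface is a torus exactly if there are `N` edges, see `EdgeIndexing`.) -/
  one_cusp : ∀ x y : Fin N × Fin 4,
    EqvGen (fun x y => ∃ f, f ≠ x.2 ∧ y = (nbr x.1 f, glue x.1 f x.2)) x y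

/-- An oriented edge of one of the (unglued) tetrahedra, from the vertex `src` to the vertex `dst`. -/
structure OEdge (N : ℕ) where
  tet : Fin N
  src : Fin 4
  dst : Fin 4
  ne : src ≠ dst

namespace OEdge

variable {N : ℕ}

/-- The same edge with the reversed orientation. -/
def rev (e : OEdge N) : OEdge N := ⟨e.tet, e.dst, e.src, e.ne.symm⟩

/-- The image of an oriented edge under the gluing of the face `f` (used if `f` contains the edge). -/
def cross (T : IdealTriangulation N) (f : Fin 4) (e : OEdge N) : OEdge N :=
  ⟨T.nbr e.tet f, T.glue e.tet f e.src, T.glue e.tet f e.dst,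
    fun h => e.ne ((T.glue e.tet f).injective h)⟩

end OEdge

/-- The three quad types: opposite edges of a tetrahedron are in the same one. -/
def quadOf : Fin 4 → Fin 4 → ZMod 3
  | 0, 2 => 0
  | 2, 0 => 0
  | 1, 3 => 0
  | 3, 1 => 0
  | 0, 1 => 1
  | 1, 0 => 1
  | 2, 3 => 1
  | 3, 2 => 1
  | _, _ => 2

/-- The shape parameters `z`, `z' = 1/(1-z)`, `z'' = 1 - 1/z` (for `□ = 0, 1, 2`). -/
noncomputable def shapeParam (s : ZMod 3) (z : ℂ) : ℂ :=
  if s = 0 then z else if s = 1 then 1 / (1 - z) else 1 - 1 / z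

/-- The logarithmic derivatives `ζ = 1/z`, `ζ' = 1/(1-z)`, `ζ'' = 1/(z(z-1))` of the shape
parameters. -/
noncomputable def zetaParam (s : ZMod 3) (z : ℂ) : ℂ :=
  if s = 0 then 1 / z else if s = 1 then 1 / (1 - z) else 1 / (z * (z - 1))

namespace IdealTriangulation

variable {N : ℕ}

/-- Two oriented edges of tetrahedra become the same oriented edge of the triangulation. -/
def EdgeRel (T : IdealTriangulation N) : OEdge N → OEdge N → Prop :=
  EqvGen fun e e' => ∃ f, f ≠ e.src ∧ f ≠ e.dst ∧ e' = OEdge.cross T f e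

/-- Let `u j v f` be integers that are attached to crossing the face `f` of `Δ_j` near its vertex `v`.
Take one copy `(k, Δ_j)` of each tetrahedron for each `k : ℤ` and glue the face `f` of `(k, Δ_j)` to a
face of `(k + u j v f, Δ_(nbr j f))`. The relation says that two oriented edges of the copies are
identified (near their initial vertex). -/
def LiftRel (T : IdealTriangulation N) (u : Fin N → Fin 4 → Fin 4 → ℤ) :
    ℤ × OEdge N → ℤ × OEdge N → Prop :=
  EqvGen fun x y => ∃ f, f ≠ x.2.src ∧ f ≠ x.2.dst ∧
    y = (x.1 + u x.2.tet x.2.src f, OEdge.cross T f x.2)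

/-- An indexing `e_1, …, e_N` of the edges of the triangulation, with an orientation of each.
(There are as many edges as tetrahedra since the boundary is a torus.) -/
structure EdgeIndexing (T : IdealTriangulation N) where
  /-- a representative of the oriented edge `e_i` -/
  edge : Fin N → OEdge N
  existsUnique : ∀ e : OEdge N,
    ∃! i, T.EdgeRel e (edge i) ∨ T.EdgeRel e.rev (edge i)

/-- The gluing equation matrices: the number of edges of `Δ_j` with parameter `z_j^□` that are
incident to `e_i`. Here the edges of quad type `q j` have the parameter `z_j`. (Each edge of `Δ_j`
that is incident to `e_i` is counted once, with the orientation which it gets from `e_i`.) -/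
noncomputable def gluing (T : IdealTriangulation N) (E : T.EdgeIndexing) (q : Fin N → ZMod 3)
    (s : ZMod 3) (i j : Fin N) : ℕ :=
  Nat.card {e : OEdge N // e.tet = j ∧ quadOf e.src e.dst - q j = s ∧ T.EdgeRel e (E.edge i)}

/-! ### Peripheral curves -/

/-- An oriented closed normal path in the triangulated peripheral torus. The `i`-th step
`turn i = (j, p)` runs through the triangle of `Δ_j` at the vertex `p 0`; it enters through the face
`p 2` and leaves through the face `p 3`, and so it turns around the corner of the triangle that lies
on the edge from `p 0` to `p 1`. -/
structure PeripheralPath (T : IdealTriangulation N) where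
  n : ℕ
  turn : Fin (n + 1) → Fin N × Equiv.Perm (Fin 4)
  closed : ∀ i, (turn (i + 1)).1 = T.nbr (turn i).1 ((turn i).2 3) ∧
    (turn (i + 1)).2 0 = T.glue (turn i).1 ((turn i).2 3) ((turn i).2 0) ∧
    (turn (i + 1)).2 2 = T.glue (turn i).1 ((turn i).2 3) ((turn i).2 3)

/-- An integral 1-cocycle on the (cell structure dual to the) triangulated peripheral torus:
`val j v f` is its value on the step from the triangle of `Δ_j` at `v` across the face `f`. It is
antisymmetric and has no monodromy around the vertices of the triangulated torus. -/
structure TorusCocycle (T : IdealTriangulation N) where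
  val : Fin N → Fin 4 → Fin 4 → ℤ
  antisymm : ∀ j v f, f ≠ v → val (T.nbr j f) (T.glue j f v) (T.glue j f f) = - val j v f
  closed : ∀ (e : OEdge N) (k l : ℤ), T.LiftRel val (k, e) (l, e) → k = l

/-- `γ` is a peripheral curve: it is freely homotopic to a homotopically non-trivial simple closed
curve. On a torus this means that its homology class is primitive, i.e. that some integral cohomology
class takes the value `1` on it. -/
def PeripheralPath.IsPeripheralCurve {T : IdealTriangulation N} (γ : T.PeripheralPath) : Prop :=
  ∃ u : T.TorusCocycle, ∑ i, u.val (γ.turn i).1 ((γ.turn i).2 0) ((γ.turn i).2 3) = 1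

/-- The path is itself a simple closed curve: it meets every triangle at most once. -/
def PeripheralPath.IsEmbedded {T : IdealTriangulation N} (γ : T.PeripheralPath) : Prop :=
  Function.Injective fun i => ((γ.turn i).1, (γ.turn i).2 0)

/-- The row vectors `C_γ^□` of the completeness equation: the signed number of corners with parameter
`z_j^□` around which `γ` turns; the sign is the direction of the turn (left or right). -/
def completeness {T : IdealTriangulation N} (γ : T.PeripheralPath) (q : Fin N → ZMod 3)
    (s : ZMod 3) (j : Fin N) : ℤ :=
  ∑ i, if (γ.turn i).1 = j ∧ quadOf ((γ.turn i).2 0) ((γ.turn i).2 1) - q j = s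
    then (Equiv.Perm.sign (γ.turn i).2 : ℤ) else 0

/-! ### Solutions, flattenings and the 1-loop invariant -/

/-- `z` is a solution of `T`: it satisfies all gluing equations and the completeness equations of all
peripheral curves. -/
structure IsSolution (T : IdealTriangulation N) (E : T.EdgeIndexing) (q : Fin N → ZMod 3)
    (z : Fin N → ℂ) : Prop where
  ne_zero : ∀ j, z j ≠ 0
  ne_one : ∀ j, z j ≠ 1
  gluing_eq : ∀ i, ∏ j, ∏ s : ZMod 3, shapeParam s (z j) ^ T.gluing E q s i j = 1
  completeness_eq : ∀ γ : T.PeripheralPath, γ.IsPeripheralCurve →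
    ∏ j, ∏ s : ZMod 3, shapeParam s (z j) ^ completeness γ q s j = 1

/-- `f` is a combinatorial flattening. -/
structure IsFlattening (T : IdealTriangulation N) (E : T.EdgeIndexing) (q : Fin N → ZMod 3)
    (f : ZMod 3 → Fin N → ℤ) : Prop where
  sum_eq : ∀ j, ∑ s, f s j = 1
  gluing_eq : ∀ i, ∑ s, ∑ j, (T.gluing E q s i j : ℤ) * f s j = 2
  completeness_eq : ∀ γ : T.PeripheralPath, γ.IsPeripheralCurve → γ.IsEmbedded →
    ∑ s, ∑ j, completeness γ q s j * f s j = 0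

/-- The 1-loop invariant with respect to the peripheral curve `γ`, at the shapes `z`, computed from
the flattening `f` after replacing the (redundant) gluing equation of the edge `e_r` by the
completeness equation of `γ`. It is well defined up to sign. -/
noncomputable def oneLoop (T : IdealTriangulation N) (E : T.EdgeIndexing) (q : Fin N → ZMod 3)
    (z : Fin N → ℂ) (γ : T.PeripheralPath) (f : ZMod 3 → Fin N → ℤ) (r : Fin N) : ℂ :=
  (1 / 2) * Matrix.det (Matrix.of fun i j : Fin N =>
      ∑ s : ZMod 3, (if i = r then (completeness γ q s j : ℂ) else (T.gluing E q s i j : ℂ))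
        * zetaParam s (z j))
    / ∏ j, ∏ s : ZMod 3, zetaParam s (z j) ^ f s j

/-! ### Ptolemy assignments -/

/-- A cocycle with values in `{±1}` on the short edges: `val j v f` is the sign of the short edge of
the truncated tetrahedron at the vertex `v` of `Δ_j` that lies in the face `f`. -/
structure SignCocycle (T : IdealTriangulation N) where
  val : Fin N → Fin 4 → Fin 4 → ℤˣ
  glue_eq : ∀ j v f, f ≠ v → val (T.nbr j f) (T.glue j f v) (T.glue j f f) = val j v f
  closed : ∀ j v, ∏ f ∈ Finset.univ.erase v, val j v f = 1

/-- The coefficient `σ(s₀₃₁) σ(s₃₀₂) / (σ(s₃₁₂) σ(s₀₂₁))` of the `σ`-Ptolemy equation of `Δ_j`, where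
`s_{abc}` is the short edge at the vertex `b` in the face that contains `a, b, c`. -/
def SignCocycle.coeff₁ {T : IdealTriangulation N} (σ : T.SignCocycle) (j : Fin N) : ℤˣ :=
  σ.val j 3 2 * σ.val j 0 1 / (σ.val j 1 0 * σ.val j 2 3)

/-- The coefficient `σ(s₀₁₃) σ(s₁₀₂) / (σ(s₁₃₂) σ(s₀₂₃))`. -/
def SignCocycle.coeff₂ {T : IdealTriangulation N} (σ : T.SignCocycle) (j : Fin N) : ℤˣ :=
  σ.val j 1 2 * σ.val j 0 3 / (σ.val j 3 0 * σ.val j 2 1)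

/-- The sign `σ(s₁₀₃) σ(s₃₂₁) / (σ(s₀₃₂) σ(s₂₁₀))` in the formula for the shape of `Δ_j`. -/
def SignCocycle.shapeSign {T : IdealTriangulation N} (σ : T.SignCocycle) (j : Fin N) : ℤˣ :=
  σ.val j 0 2 * σ.val j 2 0 / (σ.val j 3 1 * σ.val j 1 3)

/-- The left-hand side of the `σ`-Ptolemy equation of `Δ_j`, where `x a b` is the value on the oriented
edge from the vertex `a` to the vertex `b`. -/
def ptolemyExpr {T : IdealTriangulation N} {R : Type*} [CommRing R] (σ : T.SignCocycle)
    (j : Fin N) (x : ∀ a b : Fin 4, a ≠ b → R) : R :=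
  x 0 2 (by decide) * x 1 3 (by decide)
    - ((σ.coeff₁ j : ℤ) : R) * (x 0 3 (by decide) * x 1 2 (by decide))
    - ((σ.coeff₂ j : ℤ) : R) * (x 0 1 (by decide) * x 2 3 (by decide))

/-- A `σ`-Ptolemy assignment, as a function on the oriented edges. -/
structure PtolemyAssignment (T : IdealTriangulation N) (σ : T.SignCocycle) where
  val : OEdge N → ℂ
  ne_zero : ∀ e, val e ≠ 0
  val_rev : ∀ e, val e.rev = - val e
  glue_eq : ∀ e e', T.EdgeRel e e' → val e = val e'
  ptolemy : ∀ j, ptolemyExpr σ j (fun a b h => val ⟨j, a, b, h⟩) = 0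

/-- The assignment `c` corresponds to the shapes `z`: for every `j` the parameter of `Δ_j` at the edge
from `1` to `3` is the one determined by `c`. -/
def PtolemyAssignment.CorrespondsTo {T : IdealTriangulation N} {σ : T.SignCocycle}
    (c : T.PtolemyAssignment σ) (q : Fin N → ZMod 3) (z : Fin N → ℂ) : Prop :=
  ∀ j, shapeParam (quadOf 1 3 - q j) (z j) =
    - ((σ.shapeSign j : ℤ) : ℂ) *
      (c.val ⟨j, 0, 1, by decide⟩ * c.val ⟨j, 2, 3, by decide⟩
        / (c.val ⟨j, 0, 3, by decide⟩ * c.val ⟨j, 1, 2, by decide⟩))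

/-! ### The infinite cyclic cover and the Jacobian -/

/-- An epimorphism `α : π₁(M) → ℤ` together with one lift `(0, Δ_j)` of each tetrahedron to the
corresponding infinite cyclic cover (the fundamental domain). The tetrahedra of the cover are
`(k, Δ_j) = g^k · (0, Δ_j)`, and the face `f` of `(k, Δ_j)` is glued to a face of
`(k + shift j f, Δ_(nbr j f))`. Hence `α` of a closed path is the sum of the shifts of the faces that
it crosses. -/
structure CyclicCover (T : IdealTriangulation N) where
  shift : Fin N → Fin 4 → ℤ
  antisymm : ∀ j f, shift (T.nbr j f) (T.glue j f f) = - shift j f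
  /-- `α` is trivial on the loops around the edges -/
  closed : ∀ (e : OEdge N) (k l : ℤ), T.LiftRel (fun j _ f => shift j f) (k, e) (l, e) → k = l
  /-- the cover is connected, that is, `α` is onto -/
  connected : ∀ x y : ℤ × Fin N,
    EqvGen (fun x y => ∃ f, y = (x.1 + shift x.2 f, T.nbr x.2 f)) x y

/-- The value of `α` on a closed path in the peripheral torus. -/
def CyclicCover.alpha {T : IdealTriangulation N} (A : T.CyclicCover) (γ : T.PeripheralPath) : ℤ :=
  ∑ i, A.shift (γ.turn i).1 ((γ.turn i).2 3)

/-- Two oriented edges of tetrahedra of the infinite cyclic cover are the same edge of the cover. -/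
def CyclicCover.Rel {T : IdealTriangulation N} (A : T.CyclicCover) :
    ℤ × OEdge N → ℤ × OEdge N → Prop :=
  T.LiftRel fun j _ f => A.shift j f

/-- The edges `ẽ_1, …, ẽ_N, ẽ_{N+1}, …, ẽ_{N+L}` of the tetrahedra of the fundamental domain; the
first `N` of them are lifts of `e_1, …, e_N`. All orientations are induced from those of the `e_i`. -/
structure DomainEdges {T : IdealTriangulation N} (E : T.EdgeIndexing) (A : T.CyclicCover)
    (L : ℕ) where
  /-- `(0, edge s)` represents `ẽ_s` -/
  edge : Fin N ⊕ Fin L → OEdge N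
  base : ∀ i, T.EdgeRel (edge (Sum.inl i)) (E.edge i)
  /-- `ẽ_{N+l} = g^{k(l)} · ẽ_{src l}` -/
  src : Fin L → Fin N
  k : Fin L → ℤ
  lift_eq : ∀ l, A.Rel (0, edge (Sum.inr l)) (k l, edge (Sum.inl (src l)))
  /-- every edge of the tetrahedra of the fundamental domain is listed exactly once -/
  existsUnique : ∀ e : OEdge N,
    ∃! s, A.Rel (0, e) (0, edge s) ∨ A.Rel (0, e.rev) (0, edge s)

open Classical in
/-- The variable `± c_s` that belongs to an oriented edge of a tetrahedron of the fundamental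
domain. -/
noncomputable def DomainEdges.var {T : IdealTriangulation N} {E : T.EdgeIndexing}
    {A : T.CyclicCover} {L : ℕ} (D : DomainEdges E A L) (e : OEdge N) :
    MvPolynomial (Fin N ⊕ Fin L) ℂ :=
  let s := (D.existsUnique e).choose
  if A.Rel (0, e) (0, D.edge s) then MvPolynomial.X s else - MvPolynomial.X s

/-- The polynomials `p_1, …, p_{N+L}` in the variables `c_1, …, c_{N+L}`, at the value `t` of the
parameter: the left-hand sides of the `σ`-Ptolemy equations of the tetrahedra of the fundamental
domain, and `c_{N+l} - t^{-k(l)} c_{src l}`. -/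
noncomputable def DomainEdges.poly {T : IdealTriangulation N} {E : T.EdgeIndexing}
    {A : T.CyclicCover} {L : ℕ} (D : DomainEdges E A L) (σ : T.SignCocycle) (t : ℂ) :
    Fin N ⊕ Fin L → MvPolynomial (Fin N ⊕ Fin L) ℂ
  | Sum.inl j => ptolemyExpr σ j fun a b h => D.var ⟨j, a, b, h⟩
  | Sum.inr l => MvPolynomial.X (Sum.inr l)
      - MvPolynomial.C (t ^ (- D.k l)) * MvPolynomial.X (Sum.inl (D.src l))

/-- The Jacobian determinant `det (∂ p_i / ∂ c_j)`, evaluated at the point given by a `σ`-Ptolemy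
assignment, as a function of `t`. -/
noncomputable def DomainEdges.jacobianDet {T : IdealTriangulation N} {E : T.EdgeIndexing}
    {A : T.CyclicCover} {L : ℕ} (D : DomainEdges E A L) {σ : T.SignCocycle}
    (c : T.PtolemyAssignment σ) (t : ℂ) : ℂ :=
  Matrix.det (Matrix.of fun r s : Fin N ⊕ Fin L =>
    MvPolynomial.eval (fun s => c.val (D.edge s)) (MvPolynomial.pderiv s (D.poly σ t r)))

end IdealTriangulation

/-! ### Oriented trivalent ribbon graphs -/

namespace RibbonGraph

variable {X : Type*}

/-- The boundary of a `0`-chain of corners: `h (ρ x) - h (ρ² x)` is the flow through the side `x` of a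
curve that turns `h y` times around each corner `y`. -/
def bdry {R : Type*} [AddGroup R] (ρ : Equiv.Perm X) (h : X → R) (x : X) : R :=
  h (ρ x) - h (ρ (ρ x))

/-- A circulation on the trivalent graph with darts `X`, vertex rotation `ρ` and edge involution `τ`. -/
structure IsCirculation {R : Type*} [AddGroup R] (ρ τ : Equiv.Perm X) (d : X → R) : Prop where
  antisymm : ∀ x, d (τ x) = - d x
  sum_eq_zero : ∀ x, d x + d (ρ x) + d (ρ (ρ x)) = 0

/-- A closed path without backtracking, which enters and leaves triangles through the given darts. -/
structure ClosedPath (ρ τ : Equiv.Perm X) where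
  n : ℕ
  entry : Fin (n + 1) → X
  exit : Fin (n + 1) → X
  turn : ∀ i, exit i = ρ (entry i) ∨ exit i = ρ (ρ (entry i))
  step : ∀ i, entry (i + 1) = τ (exit i)

theorem isCirculation_bdry {R : Type*} [AddCommGroup R] {ρ τ : Equiv.Perm X}
    (hρ : ∀ x, ρ (ρ (ρ x)) = x) {h : X → R} (hh : ∀ x, bdry ρ h (τ x) = - bdry ρ h x) :
    IsCirculation ρ τ (bdry ρ h) where
  antisymm := hh
  sum_eq_zero x := by simp only [bdry, hρ]; abel

section Path

variable [DecidableEq X] {ρ τ : Equiv.Perm X}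

/-- The flow of a path: the number of exits minus the number of entries. -/
def ClosedPath.flux (γ : ClosedPath ρ τ) (x : X) : ℤ :=
  ∑ i, ((if γ.exit i = x then 1 else 0) - (if γ.entry i = x then 1 else 0))

/-- The signed number of turns of a path around a corner. -/
def ClosedPath.turning (γ : ClosedPath ρ τ) (x : X) : ℤ :=
  ∑ i, if γ.exit i = ρ (γ.entry i) then (if ρ (ρ (γ.entry i)) = x then 1 else 0)
    else - (if ρ (γ.entry i) = x then 1 else 0)

theorem ClosedPath.flux_eq (hτ : ∀ x, τ (τ x) = x) (γ : ClosedPath ρ τ) (x : X) :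
    γ.flux x = (∑ i, if γ.exit i = x then 1 else 0) - ∑ i, if γ.exit i = τ x then 1 else 0 := by
  rw [ClosedPath.flux, Finset.sum_sub_distrib]
  congr 1
  rw [← Equiv.sum_comp (Equiv.addRight (1 : Fin (γ.n + 1)))]
  refine Finset.sum_congr rfl fun i _ => ?_
  simp only [Equiv.coe_addRight, γ.step]
  congr 1
  rw [eq_iff_iff]
  constructor
  · intro h; rw [← h, hτ]
  · intro h; rw [h, hτ]

theorem ClosedPath.bdry_turning (hρ : ∀ x, ρ (ρ (ρ x)) = x) (hρ1 : ∀ x, ρ x ≠ x)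
    (γ : ClosedPath ρ τ) : bdry ρ γ.turning = γ.flux := by
  funext x
  have hinv : ∀ a b, ρ a = b ↔ a = ρ (ρ b) := fun a b =>
    ⟨fun h => by rw [← h, hρ], fun h => by rw [h, hρ]⟩
  simp only [bdry, ClosedPath.turning, ClosedPath.flux, ← Finset.sum_sub_distrib]
  refine Finset.sum_congr rfl fun i _ => ?_
  rcases γ.turn i with h | h
  · simp only [h, if_true, EmbeddingLike.apply_eq_iff_eq]
  · have h2 : ¬ γ.exit i = ρ (γ.entry i) := by
      rw [h]; intro h3; exact hρ1 _ (ρ.injective h3)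
    rw [if_neg h2, if_neg h2, h]
    simp only [EmbeddingLike.apply_eq_iff_eq]
    have : (γ.entry i = ρ x) ↔ (ρ (ρ (γ.entry i)) = x) := by
      rw [hinv, hinv, hρ]
    simp only [this]
    ring

theorem ClosedPath.isCirculation_flux (hρ : ∀ x, ρ (ρ (ρ x)) = x) (hρ1 : ∀ x, ρ x ≠ x)
    (hτ : ∀ x, τ (τ x) = x) (γ : ClosedPath ρ τ) : IsCirculation ρ τ γ.flux := by
  rw [← γ.bdry_turning hρ hρ1]
  refine isCirculation_bdry hρ fun x => ?_
  rw [γ.bdry_turning hρ hρ1, γ.flux_eq hτ, γ.flux_eq hτ, hτ]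
  ring

variable [Fintype X]

theorem ClosedPath.sum_mul_flux {R : Type*} [CommRing R] (γ : ClosedPath ρ τ) (h : X → R) :
    ∑ x, h x * γ.flux x = ∑ i, (h (γ.exit i) - h (γ.entry i)) := by
  simp only [ClosedPath.flux, Int.cast_sum, Finset.mul_sum]
  rw [Finset.sum_comm]
  refine Finset.sum_congr rfl fun i _ => ?_
  simp [mul_sub, Finset.sum_sub_distrib]

end Path

section Pairing

variable [Fintype X] {ρ τ : Equiv.Perm X} {R : Type*} [CommRing R]

theorem sum_mul_bdry_antisymm (hρ : ∀ x, ρ (ρ (ρ x)) = x) (h h' : X → R) :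
    ∑ x, h x * bdry ρ h' x = - ∑ x, h' x * bdry ρ h x := by
  simp only [bdry, mul_sub, Finset.sum_sub_distrib]
  have h1 : ∀ h h' : X → R, ∑ x, h x * h' (ρ x) = ∑ x, h' x * h (ρ (ρ x)) := fun h h' => by
    rw [← Equiv.sum_comp ρ (fun x => h' x * h (ρ (ρ x)))]
    exact Finset.sum_congr rfl fun x _ => by rw [hρ, mul_comm]
  rw [h1 h h', h1 h' h]
  ring

/-- The pairing with a circulation in terms of the increments of `h` across the sides. -/
theorem sum_mul_circulation (hρ : ∀ x, ρ (ρ (ρ x)) = x) {d : X → R}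
    (hd : IsCirculation ρ τ d) (h : X → R) :
    ∑ x, h x * d x = ∑ x, (h (ρ (ρ (τ x))) - h (ρ x)) * d x := by
  have e1 : ∑ x, h (ρ (ρ (τ x))) * d x = - ∑ x, h (ρ (ρ x)) * d x := by
    rw [← Equiv.sum_comp τ (fun x => h (ρ (ρ x)) * d x), ← Finset.sum_neg_distrib]
    exact Finset.sum_congr rfl fun x _ => by rw [hd.antisymm]; ring
  have e2 : ∑ x, h (ρ x) * d x = ∑ x, h x * d (ρ (ρ x)) := by
    rw [← Equiv.sum_comp ρ (fun x => h x * d (ρ (ρ x)))]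
    exact Finset.sum_congr rfl fun x _ => by rw [hρ]
  have e3 : ∑ x, h (ρ (ρ x)) * d x = ∑ x, h x * d (ρ x) := by
    rw [← Equiv.sum_comp (ρ.trans ρ) (fun x => h x * d (ρ x))]
    exact Finset.sum_congr rfl fun x _ => by simp [hρ]
  have e4 : ∑ x, h x * d x + ∑ x, h x * d (ρ x) + ∑ x, h x * d (ρ (ρ x)) = 0 := by
    rw [← Finset.sum_add_distrib, ← Finset.sum_add_distrib]
    refine Finset.sum_eq_zero fun x _ => ?_
    rw [← mul_add, ← mul_add, hd.sum_eq_zero, mul_zero]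
  simp only [sub_mul, Finset.sum_sub_distrib]
  rw [e1, e2, e3]
  linear_combination e4

theorem ClosedPath.sum_mul_flux_eq_two_mul [DecidableEq X] (hρ : ∀ x, ρ (ρ (ρ x)) = x)
    (hρ1 : ∀ x, ρ x ≠ x) (hτ : ∀ x, τ (τ x) = x) (γ : ClosedPath ρ τ) {h : X → R}
    (hh : ∀ x, bdry ρ h (τ x) = - bdry ρ h x) :
    ∑ x, h x * γ.flux x = 2 * ∑ i, (h (ρ (ρ (τ (γ.exit i)))) - h (ρ (γ.exit i))) := by
  have hc : IsCirculation ρ τ (fun x => (γ.flux x : R)) := by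
    have := γ.isCirculation_flux hρ hρ1 hτ
    refine ⟨fun x => ?_, fun x => ?_⟩
    · rw [this.antisymm]; push_cast; rfl
    · have := this.sum_eq_zero x; exact_mod_cast congrArg (Int.cast : ℤ → R) this
  rw [sum_mul_circulation hρ hc, γ.sum_mul_flux (fun x => h (ρ (ρ (τ x))) - h (ρ x)),
    Finset.sum_sub_distrib,
    ← Equiv.sum_comp (Equiv.addRight (1 : Fin (γ.n + 1)))
      (fun i => h (ρ (ρ (τ (γ.entry i)))) - h (ρ (γ.entry i))), two_mul, sub_eq_add_neg,
    ← Finset.sum_neg_distrib]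
  congr 1
  refine Finset.sum_congr rfl fun i _ => ?_
  simp only [Equiv.coe_addRight, γ.step, hτ]
  have := hh (γ.exit i)
  simp only [bdry] at this
  linear_combination this

end Pairing

section Decomposition

variable [Fintype X] {ρ τ : Equiv.Perm X}

/-- A nonzero integral circulation contains a simple directed cycle. -/
theorem exists_closedPath_of_pos {d : X → ℤ} (hd : IsCirculation ρ τ d)
    {x₀ : X} (hx₀ : 0 < d x₀) :
    ∃ γ : ClosedPath ρ τ, Function.Injective γ.exit ∧ ∀ i, 0 < d (γ.exit i) := by
  classical
  let F : X → X := fun x => if 0 < d (ρ (τ x)) then ρ (τ x) else ρ (ρ (τ x))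
  have hF : ∀ x, 0 < d x → 0 < d (F x) := by
    intro x hx
    simp only [F]
    split_ifs with h
    · exact h
    · have h1 := hd.sum_eq_zero (τ x)
      have h2 := hd.antisymm x
      omega
  have hFk : ∀ k x, 0 < d x → 0 < d (F^[k] x) := by
    intro k
    induction k with
    | zero => intro x hx; exact hx
    | succ k ih => intro x hx; rw [Function.iterate_succ_apply]; exact ih _ (hF x hx)
  obtain ⟨i, j, hij, he⟩ := Finite.exists_ne_map_eq_of_infinite (fun k : ℕ => F^[k] x₀)
  wlog hlt : i < j generalizing i j
  · exact this j i hij.symm he.symm (by omega)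
  set y := F^[i] x₀ with hy
  have hper : Function.IsPeriodicPt F (j - i) y := by
    change F^[j - i] y = y
    rw [hy, ← Function.iterate_add_apply, Nat.sub_add_cancel hlt.le]
    exact he.symm
  have hpos : 0 < Function.minimalPeriod F y :=
    Function.IsPeriodicPt.minimalPeriod_pos (by omega) hper
  obtain ⟨n, hn⟩ : ∃ n, Function.minimalPeriod F y = n + 1 := ⟨_, (Nat.succ_pred_eq_of_pos hpos).symm⟩
  have hperiod : F^[n + 1] y = y := by rw [← hn]; exact Function.isPeriodicPt_minimalPeriod F y
  have hperiod' : ∀ k, F^[k + (n + 1)] y = F^[k] y := fun k => by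
    rw [Function.iterate_add_apply, hperiod]
  refine ⟨⟨n, fun i => τ (F^[i + n] y), fun i => F^[i] y, ?_, ?_⟩, ?_, ?_⟩
  · intro i
    have : F^[(i : ℕ)] y = F (F^[i + n] y) := by
      rw [← Function.iterate_succ_apply' F, ← hperiod' i]; rfl
    rw [this]
    simp only [F]
    split_ifs
    · exact Or.inl rfl
    · exact Or.inr rfl
  · intro i
    congr 1
    rcases eq_or_ne i (Fin.last n) with rfl | h
    · simp
    · rw [Fin.val_add_one_of_lt (Fin.lt_last_iff_ne_last.2 h), add_assoc, add_comm 1 n, hperiod']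
  · intro i j hij
    refine Fin.ext (Function.iterate_injOn_Iio_minimalPeriod (f := F) (x := y) ?_ ?_ hij)
    · rw [hn]; exact i.2
    · rw [hn]; exact j.2
  · intro i
    exact hFk _ _ (hFk _ _ hx₀)

theorem IsCirculation.mem_closure_flux [DecidableEq X] (hρ : ∀ x, ρ (ρ (ρ x)) = x) (hρ1 : ∀ x, ρ x ≠ x)
    (hτ : ∀ x, τ (τ x) = x) {d : X → ℤ} (hd : IsCirculation ρ τ d) :
    d ∈ AddSubgroup.closure (Set.range (ClosedPath.flux : ClosedPath ρ τ → X → ℤ)) := by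
  induction hk : ∑ x, (d x).natAbs using Nat.strong_induction_on generalizing d with
  | _ k ih =>
  by_cases h0 : ∀ x, d x ≤ 0
  · have : d = 0 := by
      funext x
      have h1 := h0 x
      have h2 := h0 (τ x)
      rw [hd.antisymm] at h2
      simp only [Pi.zero_apply]
      omega
    rw [this]; exact zero_mem _
  · push Not at h0
    obtain ⟨x₀, hx₀⟩ := h0
    obtain ⟨γ, hinj, hγ⟩ := exists_closedPath_of_pos hd hx₀
    have hcirc := γ.isCirculation_flux hρ hρ1 hτ
    have hE : ∀ x, ((∑ i, if γ.exit i = x then (1 : ℤ) else 0) = 0) ∨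
        ((∑ i, if γ.exit i = x then (1 : ℤ) else 0) = 1 ∧ 0 < d x) := by
      intro x
      by_cases hx : ∃ i, γ.exit i = x
      · obtain ⟨i, rfl⟩ := hx
        right
        refine ⟨?_, hγ i⟩
        simp [hinj.eq_iff]
      · left
        push Not at hx
        simp [hx]
    have hle : ∀ x, (d x - γ.flux x).natAbs ≤ (d x).natAbs := by
      intro x
      rw [γ.flux_eq hτ]
      have h1 := hE x
      have h2 := hE (τ x)
      rw [hd.antisymm] at h2
      omega
    have hlt : ∑ x, (d x - γ.flux x).natAbs < ∑ x, (d x).natAbs := by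
      refine Finset.sum_lt_sum (fun x _ => hle x) ⟨γ.exit 0, Finset.mem_univ _, ?_⟩
      have h3 : (∑ i, if γ.exit i = γ.exit 0 then (1 : ℤ) else 0) = 1 := by simp [hinj.eq_iff]
      rw [γ.flux_eq hτ, h3]
      have h1 := hγ 0
      have h2 := hE (τ (γ.exit 0))
      rw [hd.antisymm] at h2
      omega
    have hsub : IsCirculation ρ τ (d - γ.flux) := by
      refine ⟨fun x => ?_, fun x => ?_⟩
      · simp only [Pi.sub_apply, hd.antisymm, hcirc.antisymm]; ring
      · have h1 := hd.sum_eq_zero x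
        have h2 := hcirc.sum_eq_zero x
        simp only [Pi.sub_apply]
        linarith
    have := ih _ (hk ▸ hlt) hsub rfl
    rw [← sub_add_cancel d γ.flux]
    exact add_mem this (AddSubgroup.subset_closure ⟨γ, rfl⟩)

end Decomposition

end RibbonGraph

namespace RibbonGraph

variable {X : Type*}

section LinearAlgebra

variable (ρ τ : Equiv.Perm X)

/-- The functions on the vertices of the triangulated surface. -/
def vertexFunctions : Submodule ℂ (X → ℂ) where
  carrier := {v | ∀ x, v (ρ (ρ (τ x))) = v (ρ x)}
  add_mem' ha hb x := by simp only [Pi.add_apply, ha x, hb x]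
  zero_mem' _ := rfl
  smul_mem' c a ha x := by simp only [Pi.smul_apply, ha x]

/-- The functions that are invariant under a permutation. -/
def invariants (π : Equiv.Perm X) : Submodule ℂ (X → ℂ) where
  carrier := {v | ∀ x, v (π x) = v x}
  add_mem' ha hb x := by simp only [Pi.add_apply, ha x, hb x]
  zero_mem' _ := rfl
  smul_mem' c a ha x := by simp only [Pi.smul_apply, ha x]

/-- The space of circulations. -/
def circulations : Submodule ℂ (X → ℂ) where
  carrier := {d | IsCirculation ρ τ d}
  add_mem' {a b} ha hb := ⟨fun x => by simp only [Pi.add_apply, ha.antisymm, hb.antisymm]; ring,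
    fun x => by
      have h1 := ha.sum_eq_zero x
      have h2 := hb.sum_eq_zero x
      simp only [Pi.add_apply]; linear_combination h1 + h2⟩
  zero_mem' := ⟨fun x => by simp, fun x => by simp⟩
  smul_mem' c a ha := ⟨fun x => by simp only [Pi.smul_apply, ha.antisymm, smul_neg],
    fun x => by
      have h1 := ha.sum_eq_zero x
      simp only [Pi.smul_apply, smul_eq_mul]; linear_combination c * h1⟩

/-- `bdry` as a linear map. -/
def bdryLinear : (X → ℂ) →ₗ[ℂ] (X → ℂ) where
  toFun := bdry ρ
  map_add' a b := by funext x; simp only [bdry, Pi.add_apply]; ring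
  map_smul' c a := by funext x; simp only [bdry, Pi.smul_apply, smul_eq_mul, RingHom.id_apply]; ring

variable {ρ τ}

/-- A fixed point free involution of a finite set has at least half as many orbits. -/
theorem card_le_two_mul_finrank_invariants [Fintype X] (hτ : ∀ x, τ (τ x) = x)
    (hτ1 : ∀ x, τ x ≠ x) : Fintype.card X ≤ 2 * Module.finrank ℂ (invariants τ) := by
  classical
  let φ := Fintype.equivFin X
  let ε : X → ℂ := fun x => if φ x < φ (τ x) then 1 else -1
  have hε : ∀ x, ε (τ x) = - ε x := by
    intro x
    have : φ x ≠ φ (τ x) := fun h => hτ1 x (φ.injective h).symm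
    simp only [ε, hτ]
    rcases lt_or_gt_of_ne this with h | h
    · simp [h, not_lt.2 h.le]
    · simp [h, not_lt.2 h.le]
  have hε2 : ∀ x, ε x * ε x = 1 := by
    intro x; simp only [ε]; split_ifs <;> norm_num
  let g : (X → ℂ) →ₗ[ℂ] invariants τ × invariants τ :=
    { toFun := fun f => (⟨fun x => f x + f (τ x), fun x => by simp only [hτ]; ring⟩,
        ⟨fun x => ε x * (f x - f (τ x)), fun x => by simp only [hτ, hε]; ring⟩)
      map_add' := fun a b => by
        ext x <;> simp <;> ring
      map_smul' := fun c a => by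
        ext x <;> simp <;> ring }
  have hg : Function.Injective g := by
    rw [← LinearMap.ker_eq_bot, LinearMap.ker_eq_bot']
    intro f hf
    funext x
    have h1 : f x + f (τ x) = 0 := congrFun (congrArg (fun p => (p.1 : X → ℂ)) hf) x
    have h2 : ε x * (f x - f (τ x)) = 0 := congrFun (congrArg (fun p => (p.2 : X → ℂ)) hf) x
    have h3 : f x - f (τ x) = 0 := by
      linear_combination ε x * h2 - (f x - f (τ x)) * hε2 x
    simp only [Pi.zero_apply]
    linear_combination (h1 + h3) / 2
  have := LinearMap.finrank_le_finrank_of_injective hg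
  rw [Module.finrank_prod, Module.finrank_fintype_fun_eq_card] at this
  omega

theorem finrank_le_one_of_constant (W : Submodule ℂ (X → ℂ)) (x₀ : X)
    (hW : ∀ f ∈ W, ∀ x, f x = f x₀) : Module.finrank ℂ W ≤ 1 := by
  let ev : W →ₗ[ℂ] ℂ := (LinearMap.proj x₀).comp W.subtype
  have : Function.Injective ev := by
    rw [← LinearMap.ker_eq_bot, LinearMap.ker_eq_bot']
    rintro ⟨f, hf⟩ h0
    ext x
    change f x = 0
    rw [hW f hf x]; exact h0
  simpa using LinearMap.finrank_le_finrank_of_injective this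

theorem finrank_circulations_le [Fintype X] (hτ : ∀ x, τ (τ x) = x)
    (hτ1 : ∀ x, τ x ≠ x) (hconn : ∀ f : X → ℂ, f ∈ invariants ρ → f ∈ invariants τ →
      ∀ x y, f x = f y) (x₀ : X) :
    2 * Module.finrank ℂ (circulations ρ τ) + 2 * Module.finrank ℂ (invariants ρ)
      ≤ Fintype.card X + 2 := by
  classical
  let B : LinearMap.BilinForm ℂ (X → ℂ) := Matrix.toBilin' 1
  have hB : ∀ f g, B f g = ∑ x, f x * g x := fun f g => by
    simp [B, Matrix.toBilin'_apply', dotProduct]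
  have hnd : B.Nondegenerate :=
    Matrix.nondegenerate_toBilin'_iff.2 (Matrix.nondegenerate_of_det_ne_zero (by simp))
  have hrefl : B.IsRefl := fun f g h => by
    rw [hB] at h ⊢; rw [← h]; exact Finset.sum_congr rfl fun x _ => mul_comm _ _
  have hle : circulations ρ τ ≤ B.orthogonal (invariants ρ ⊔ invariants τ) := by
    intro d hd
    rw [LinearMap.BilinForm.mem_orthogonal_iff]
    intro f hf
    obtain ⟨a, ha, b, hb, rfl⟩ := Submodule.mem_sup.1 hf
    change B _ _ = 0
    rw [hB]
    have h1 : ∑ x, a x * d x = 0 := by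
      have e1 : ∑ x, a x * d (ρ x) = ∑ x, a x * d x := by
        rw [← Equiv.sum_comp ρ (fun x => a x * d x)]
        exact Finset.sum_congr rfl fun x _ => by rw [ha x]
      have e2 : ∑ x, a x * d (ρ (ρ x)) = ∑ x, a x * d x := by
        rw [← e1, ← Equiv.sum_comp ρ (fun x => a x * d (ρ x))]
        exact Finset.sum_congr rfl fun x _ => by rw [ha x]
      have e3 : ∑ x, a x * d x + ∑ x, a x * d (ρ x) + ∑ x, a x * d (ρ (ρ x)) = 0 := by
        rw [← Finset.sum_add_distrib, ← Finset.sum_add_distrib]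
        refine Finset.sum_eq_zero fun x _ => ?_
        rw [← mul_add, ← mul_add, hd.sum_eq_zero, mul_zero]
      rw [e1, e2] at e3
      linear_combination e3 / 3
    have h2 : ∑ x, b x * d x = 0 := by
      have e1 : ∑ x, b x * d x = - ∑ x, b x * d x := by
        conv_lhs => rw [← Equiv.sum_comp τ (fun x => b x * d x)]
        rw [← Finset.sum_neg_distrib]
        exact Finset.sum_congr rfl fun x _ => by rw [hb x, hd.antisymm]; ring
      linear_combination e1 / 2
    simp only [Pi.add_apply, add_mul, Finset.sum_add_distrib, h1, h2, add_zero]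
  have h1 := Submodule.finrank_mono hle
  rw [LinearMap.BilinForm.finrank_orthogonal hnd,
    Module.finrank_fintype_fun_eq_card] at h1
  have h2 := Submodule.finrank_sup_add_finrank_inf_eq (invariants ρ) (invariants τ)
  have h3 := finrank_le_one_of_constant (invariants ρ ⊓ invariants τ) x₀
    (fun f hf x => hconn f hf.1 hf.2 x x₀)
  have h4 := card_le_two_mul_finrank_invariants hτ hτ1
  have h5 := Submodule.finrank_le (invariants ρ ⊔ invariants τ)
  rw [Module.finrank_fintype_fun_eq_card] at h5
  omega

theorem finrank_vertexFunctions_le [Fintype X] (hρ : ∀ x, ρ (ρ (ρ x)) = x)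
    (hconn : ∀ f : X → ℂ, f ∈ invariants ρ → f ∈ invariants τ → ∀ x y, f x = f y) (x₀ : X) :
    Module.finrank ℂ (vertexFunctions ρ τ)
      ≤ Module.finrank ℂ ((vertexFunctions ρ τ).map (bdryLinear ρ)) + 1 := by
  have h1 := LinearMap.finrank_range_add_finrank_ker
    ((bdryLinear ρ).domRestrict (vertexFunctions ρ τ))
  rw [LinearMap.range_domRestrict] at h1
  have h2 : Module.finrank ℂ (LinearMap.ker ((bdryLinear ρ).domRestrict (vertexFunctions ρ τ)))
      ≤ 1 := by
    rw [← Submodule.finrank_map_subtype_eq]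
    refine finrank_le_one_of_constant _ x₀ ?_
    rintro _ ⟨⟨f, hf⟩, hf0, rfl⟩
    have hρf : ∀ x, f (ρ x) = f x := by
      intro x
      have : bdry ρ f (ρ (ρ x)) = 0 := congrFun (LinearMap.mem_ker.1 hf0) (ρ (ρ x))
      simp only [bdry, hρ] at this
      exact (sub_eq_zero.1 this).symm
    have hτf : ∀ x, f (τ x) = f x := by
      intro x
      have := hf x
      rwa [hρf, hρf, hρf] at this
    exact fun x => hconn f hρf hτf x x₀
  omega

theorem sum_vertexFunction_mul_circulation [Fintype X] (hρ : ∀ x, ρ (ρ (ρ x)) = x) {v d : X → ℂ}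
    (hv : v ∈ vertexFunctions ρ τ) (hd : IsCirculation ρ τ d) : ∑ x, v x * d x = 0 := by
  rw [sum_mul_circulation hρ hd]
  exact Finset.sum_eq_zero fun x _ => by rw [hv x, sub_self, zero_mul]

theorem bdry_intCast (h : X → ℤ) (x : X) : bdry ρ (fun y => (h y : ℂ)) x = (bdry ρ h x : ℤ) := by
  simp [bdry]

end LinearAlgebra

section Duality

variable {ρ τ : Equiv.Perm X}

/-- The value on a closed path of the cocycle with potential `h`. -/
def ClosedPath.increment {R : Type*} [AddCommGroup R] (γ : ClosedPath ρ τ) (h : X → R) : R :=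
  ∑ i, (h (ρ (ρ (τ (γ.exit i)))) - h (ρ (γ.exit i)))

variable [Fintype X] [DecidableEq X]

/-- On a torus, a circulation with zero intersection number with a given path that is not homologous
to zero is homologous to a multiple of the path. -/
theorem exists_bdry_eq_smul_flux_add (hρ : ∀ x, ρ (ρ (ρ x)) = x) (hρ1 : ∀ x, ρ x ≠ x)
    (hτ : ∀ x, τ (τ x) = x) (hτ1 : ∀ x, τ x ≠ x)
    (hconn : ∀ f : X → ℂ, f ∈ invariants ρ → f ∈ invariants τ → ∀ x y, f x = f y)
    (hcard : Fintype.card X ≤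
      2 * Module.finrank ℂ (invariants ρ) + 2 * Module.finrank ℂ (vertexFunctions ρ τ))
    (γ : ClosedPath ρ τ) {u α : X → ℂ} (hu : ∀ x, bdry ρ u (τ x) = - bdry ρ u x)
    (hα : ∀ x, bdry ρ α (τ x) = - bdry ρ α x)
    (huγ : ∑ x, u x * γ.flux x ≠ 0) (hαγ : ∑ x, α x * γ.flux x = 0) :
    ∃ a : ℂ, ∃ v ∈ vertexFunctions ρ τ, ∀ x, bdry ρ α x = a * γ.flux x + bdry ρ v x := by
  set n : X → ℂ := fun x => γ.turning x
  set d : X → ℂ := fun x => γ.flux x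
  have hnd : bdry ρ n = d := by
    funext x; rw [bdry_intCast, γ.bdry_turning hρ hρ1]
  have hd : IsCirculation ρ τ d := by
    have := γ.isCirculation_flux hρ hρ1 hτ
    refine ⟨fun x => ?_, fun x => ?_⟩
    · simp only [d]; rw [this.antisymm]; push_cast; rfl
    · have := this.sum_eq_zero x
      simp only [d]
      exact_mod_cast congrArg (Int.cast : ℤ → ℂ) this
  set W := (vertexFunctions ρ τ).map (bdryLinear ρ)
  let ℓ : (X → ℂ) →ₗ[ℂ] ℂ := ∑ x, n x • LinearMap.proj x
  have hℓ : ∀ f, ℓ f = ∑ x, n x * f x := fun f => by simp [ℓ]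
  set Z := circulations ρ τ
  have hpot : ∀ h : X → ℂ, ℓ (bdry ρ h) = - ∑ x, h x * d x := fun h => by
    rw [hℓ, sum_mul_bdry_antisymm hρ, hnd]
  have hWZ : W ≤ Z ⊓ LinearMap.ker ℓ := by
    rintro _ ⟨v, hv, rfl⟩
    refine ⟨isCirculation_bdry hρ fun x => ?_, ?_⟩
    · have h1 := hv x
      have h2 := hv (τ x)
      rw [hτ] at h2
      simp only [bdry, h1, h2, neg_sub]
    · change ℓ (bdry ρ v) = 0
      rw [hpot, sum_vertexFunction_mul_circulation hρ hv hd, neg_zero]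
  have hdZ : d ∈ Z ⊓ LinearMap.ker ℓ := by
    refine ⟨hd, ?_⟩
    change ℓ d = 0
    have := hpot n
    rw [hnd, ← hℓ] at this
    linear_combination this / 2
  have hαZ : bdry ρ α ∈ Z ⊓ LinearMap.ker ℓ := by
    refine ⟨isCirculation_bdry hρ hα, ?_⟩
    change ℓ (bdry ρ α) = 0
    rw [hpot, hαγ, neg_zero]
  have huZ : bdry ρ u ∈ Z := isCirculation_bdry hρ hu
  have hlt1 : Module.finrank ℂ ↥(Z ⊓ LinearMap.ker ℓ) < Module.finrank ℂ Z := by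
    refine Submodule.finrank_lt_finrank_of_lt (lt_of_le_of_ne inf_le_left fun h => ?_)
    have h0 : ℓ (bdry ρ u) = 0 := (h.symm ▸ huZ : bdry ρ u ∈ Z ⊓ LinearMap.ker ℓ).2
    rw [hpot, neg_eq_zero] at h0
    exact huγ h0
  have hdW : d ∉ W := by
    rintro ⟨v, hv, hvd⟩
    change bdry ρ v = d at hvd
    apply huγ
    change ∑ x, u x * d x = 0
    rw [← hvd, sum_mul_bdry_antisymm hρ,
      sum_vertexFunction_mul_circulation hρ hv (isCirculation_bdry hρ hu), neg_zero]
  have hlt2 : Module.finrank ℂ W < Module.finrank ℂ ↥(W ⊔ ℂ ∙ d) := by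
    refine Submodule.finrank_lt_finrank_of_lt (lt_of_le_of_ne le_sup_left fun h => hdW ?_)
    rw [h]
    exact Submodule.mem_sup_right (Submodule.mem_span_singleton_self d)
  have hle : W ⊔ ℂ ∙ d ≤ Z ⊓ LinearMap.ker ℓ :=
    sup_le hWZ ((Submodule.span_singleton_le_iff_mem _ _).2 hdZ)
  have h3 : 2 * Module.finrank ℂ Z + 2 * Module.finrank ℂ (invariants ρ) ≤ Fintype.card X + 2 :=
    finrank_circulations_le hτ hτ1 hconn (γ.exit 0)
  have h4 : Module.finrank ℂ (vertexFunctions ρ τ) ≤ Module.finrank ℂ W + 1 :=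
    finrank_vertexFunctions_le hρ hconn (γ.exit 0)
  have heq := Submodule.eq_of_le_of_finrank_le hle (by omega)
  rw [← heq] at hαZ
  obtain ⟨_, ⟨v, hv, rfl⟩, y, hy, hs⟩ := Submodule.mem_sup.1 hαZ
  obtain ⟨a, rfl⟩ := Submodule.mem_span_singleton.1 hy
  refine ⟨a, v, hv, fun x => ?_⟩
  rw [← hs]
  change bdry ρ v x + a * d x = _
  ring

/-- The coefficient in `exists_bdry_eq_smul_flux_add` for a primitive path and integral data: it
generates the group of values of `α`, up to sign. -/
theorem exists_bdry_eq_natCast_mul_flux_add (hρ : ∀ x, ρ (ρ (ρ x)) = x) (hρ1 : ∀ x, ρ x ≠ x)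
    (hτ : ∀ x, τ (τ x) = x) (hτ1 : ∀ x, τ x ≠ x)
    (hconn : ∀ f : X → ℂ, f ∈ invariants ρ → f ∈ invariants τ → ∀ x y, f x = f y)
    (hcard : Fintype.card X ≤
      2 * Module.finrank ℂ (invariants ρ) + 2 * Module.finrank ℂ (vertexFunctions ρ τ))
    (γ : ClosedPath ρ τ) {u α : X → ℤ} (hu : ∀ x, bdry ρ u (τ x) = - bdry ρ u x)
    (hα : ∀ x, bdry ρ α (τ x) = - bdry ρ α x)
    (huγ : γ.increment u = 1) (hαγ : γ.increment α = 0) (m : ℕ)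
    (hm : AddSubgroup.closure (Set.range fun δ : ClosedPath ρ τ => δ.increment α)
      = AddSubgroup.zmultiples (m : ℤ)) :
    ∃ a : ℂ, (a = m ∨ a = - m) ∧ ∃ v ∈ vertexFunctions ρ τ,
      ∀ x, bdry ρ (fun y => (α y : ℂ)) x = a * γ.flux x + bdry ρ v x := by
  have hpair : ∀ (h : X → ℤ), (∀ x, bdry ρ h (τ x) = - bdry ρ h x) → ∀ δ : ClosedPath ρ τ,
      ∑ x, h x * δ.flux x = 2 * δ.increment h := fun h hh δ =>
    δ.sum_mul_flux_eq_two_mul hρ hρ1 hτ hh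
  have hcast : ∀ h : X → ℤ, (∀ x, bdry ρ h (τ x) = - bdry ρ h x) →
      ∀ x, bdry ρ (fun y => (h y : ℂ)) (τ x) = - bdry ρ (fun y => (h y : ℂ)) x := fun h hh x => by
    rw [bdry_intCast, bdry_intCast, hh]; push_cast; rfl
  have hpairC : ∀ (h : X → ℤ), (∀ x, bdry ρ h (τ x) = - bdry ρ h x) → ∀ δ : ClosedPath ρ τ,
      ∑ x, (h x : ℂ) * δ.flux x = 2 * (δ.increment h : ℤ) := fun h hh δ => by
    exact_mod_cast congrArg (Int.cast : ℤ → ℂ) (hpair h hh δ)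
  obtain ⟨a, v, hv, hav⟩ := exists_bdry_eq_smul_flux_add hρ hρ1 hτ hτ1 hconn hcard γ
    (hcast u hu) (hcast α hα) (by rw [hpairC u hu, huγ]; norm_num)
    (by rw [hpairC α hα, hαγ]; norm_num)
  have hturn : ∀ δ : ClosedPath ρ τ, ∀ x, bdry ρ δ.turning (τ x) = - bdry ρ δ.turning x := by
    intro δ x
    rw [δ.bdry_turning hρ hρ1, (δ.isCirculation_flux hρ hρ1 hτ).antisymm]
  have hval : ∀ δ : ClosedPath ρ τ,
      ((δ.increment α : ℤ) : ℂ) = a * (δ.increment γ.turning : ℤ) := by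
    intro δ
    have h1 : ∑ x, (δ.turning x : ℂ) * bdry ρ (fun y => (α y : ℂ)) x
        = a * ∑ x, (δ.turning x : ℂ) * γ.flux x := by
      simp only [hav, mul_add, Finset.sum_add_distrib]
      have h2 : ∑ x, (δ.turning x : ℂ) * bdry ρ v x = 0 := by
        rw [sum_mul_bdry_antisymm hρ, sum_vertexFunction_mul_circulation hρ hv
          (isCirculation_bdry hρ (hcast _ (hturn δ))), neg_zero]
      rw [h2, add_zero, Finset.mul_sum]
      exact Finset.sum_congr rfl fun x _ => by ring
    have hb : ∀ δ' : ClosedPath ρ τ, ∀ x,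
        (δ'.flux x : ℂ) = bdry ρ (fun y => (δ'.turning y : ℂ)) x := fun δ' x => by
      rw [bdry_intCast, δ'.bdry_turning hρ hρ1]
    have h3 := sum_mul_bdry_antisymm hρ (fun x => (δ.turning x : ℂ)) (fun x => (α x : ℂ))
    have h4 := sum_mul_bdry_antisymm hρ (fun x => (δ.turning x : ℂ)) (fun x => (γ.turning x : ℂ))
    simp only [← hb] at h3 h4
    rw [hpairC α hα] at h3
    rw [hpairC _ (hturn γ)] at h4
    linear_combination h3 / 2 - h1 / 2 - a * h4 / 2
  have hone : ∃ y : ℤ, a = m * y := by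
    have hmem := (isCirculation_bdry hρ hu).mem_closure_flux hρ hρ1 hτ
    have key : ∀ d ∈ AddSubgroup.closure (Set.range (ClosedPath.flux : ClosedPath ρ τ → X → ℤ)),
        ∃ y : ℤ, a * ∑ x, (γ.turning x : ℂ) * d x = 2 * (m * y) := by
      intro d hd
      induction hd using AddSubgroup.closure_induction with
      | mem d hd =>
        obtain ⟨δ, rfl⟩ := hd
        have h1 : δ.increment α ∈ AddSubgroup.zmultiples (m : ℤ) := by
          rw [← hm]; exact AddSubgroup.subset_closure ⟨δ, rfl⟩
        obtain ⟨y, hy⟩ := AddSubgroup.mem_zmultiples_iff.1 h1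
        refine ⟨y, ?_⟩
        rw [hpairC _ (hturn γ), mul_left_comm, ← hval, ← hy]
        push_cast [smul_eq_mul]; ring
      | zero => exact ⟨0, by simp⟩
      | add d d' _ _ h h' =>
        obtain ⟨y, hy⟩ := h
        obtain ⟨y', hy'⟩ := h'
        refine ⟨y + y', ?_⟩
        simp only [Pi.add_apply, Int.cast_add, mul_add, Finset.sum_add_distrib]
        rw [hy, hy']
      | neg d _ h =>
        obtain ⟨y, hy⟩ := h
        refine ⟨-y, ?_⟩
        simp only [Pi.neg_apply, Int.cast_neg, mul_neg, Finset.sum_neg_distrib]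
        rw [hy]
    obtain ⟨y, hy⟩ := key _ hmem
    refine ⟨-y, ?_⟩
    have h1 : ∑ x, (γ.turning x : ℂ) * (bdry ρ u x : ℤ) = -2 := by
      have := sum_mul_bdry_antisymm hρ γ.turning u
      rw [γ.bdry_turning hρ hρ1] at this
      have h2 := hpair u hu γ
      rw [h2, huγ] at this
      exact_mod_cast congrArg (Int.cast : ℤ → ℂ) this
    rw [h1] at hy
    push_cast
    linear_combination -hy / 2
  have htwo : ∃ k : ℤ, (m : ℂ) = a * k := by
    have h1 : (m : ℤ) ∈ AddSubgroup.closure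
        (Set.range fun δ : ClosedPath ρ τ => δ.increment α) := by
      rw [hm]; exact AddSubgroup.mem_zmultiples _
    have key : ∀ y ∈ AddSubgroup.closure (Set.range fun δ : ClosedPath ρ τ => δ.increment α),
        ∃ k : ℤ, (y : ℂ) = a * k := by
      intro y hy
      induction hy using AddSubgroup.closure_induction with
      | mem y hy => obtain ⟨δ, rfl⟩ := hy; exact ⟨_, hval δ⟩
      | zero => exact ⟨0, by simp⟩
      | add y y' _ _ h h' =>
        obtain ⟨k, hk⟩ := h
        obtain ⟨k', hk'⟩ := h'
        exact ⟨k + k', by push_cast; rw [hk, hk']; ring⟩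
      | neg y _ h =>
        obtain ⟨k, hk⟩ := h
        exact ⟨-k, by push_cast; rw [hk]; ring⟩
    simpa using key _ h1
  refine ⟨a, ?_, v, hv, hav⟩
  obtain ⟨y, hy⟩ := hone
  obtain ⟨k, hk⟩ := htwo
  rcases Nat.eq_zero_or_pos m with rfl | hpos
  · left; rw [hy]; simp
  · have h1 : (m : ℂ) * (y * k) = m * 1 := by rw [← mul_assoc, ← hy, ← hk, mul_one]
    have h2 : (y : ℂ) * k = 1 := mul_left_cancel₀ (by exact_mod_cast hpos.ne') h1
    have h3 : y * k = 1 := by exact_mod_cast h2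
    rcases Int.eq_one_or_neg_one_of_mul_eq_one h3 with rfl | rfl
    · left; rw [hy]; simp
    · right; rw [hy]; simp

end Duality

end RibbonGraph

/-! ### The ribbon graph of the triangulated peripheral torus -/

/-- The cyclic order of the other vertices around the vertex `v`: `(v, w, next v w, next² v w)` is an
even permutation of the vertices. -/
def nextVertex : Fin 4 → Fin 4 → Fin 4 :=
  ![![0, 2, 3, 1], ![3, 1, 0, 2], ![1, 3, 2, 0], ![2, 0, 1, 3]]

theorem nextVertex_three : ∀ v w, nextVertex v (nextVertex v (nextVertex v w)) = w := by decide

theorem nextVertex_ne : ∀ v w, v ≠ w → v ≠ nextVertex v w := by decide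

theorem nextVertex_ne_self : ∀ v w, v ≠ w → nextVertex v w ≠ w := by decide

theorem eq_nextVertex_or : ∀ v w f : Fin 4, v ≠ w → f ≠ v → f ≠ w →
    w = nextVertex v f ∨ w = nextVertex v (nextVertex v f) := by decide

theorem nextVertex_of_sign_one : ∀ p : Equiv.Perm (Fin 4), Equiv.Perm.sign p = 1 →
    p 3 = nextVertex (p 0) (p 2) ∧ p 1 = nextVertex (p 0) (nextVertex (p 0) (p 2)) := by decide

theorem nextVertex_of_sign_neg_one : ∀ p : Equiv.Perm (Fin 4), Equiv.Perm.sign p = -1 →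
    p 3 = nextVertex (p 0) (nextVertex (p 0) (p 2)) ∧ p 1 = nextVertex (p 0) (p 2) := by decide

theorem exists_even_perm : ∀ v w : Fin 4, v ≠ w →
    ∃ p : Equiv.Perm (Fin 4), Equiv.Perm.sign p = 1 ∧ p 0 = v ∧ p 2 = w := by decide

theorem nextVertex_perm_of_sign_neg {g : Equiv.Perm (Fin 4)} (hg : Equiv.Perm.sign g = -1)
    {v w : Fin 4} (h : v ≠ w) :
    nextVertex (g v) (nextVertex (g v) (g w)) = g (nextVertex v w) := by
  obtain ⟨p, hp, rfl, rfl⟩ := exists_even_perm v w h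
  rw [← (nextVertex_of_sign_one p hp).1]
  exact (nextVertex_of_sign_neg_one (g * p) (by rw [map_mul, hg, hp]; rfl)).1.symm

theorem exists_perm_of_ne : ∀ v a b : Fin 4, v ≠ a → v ≠ b → a ≠ b →
    ∃ p : Equiv.Perm (Fin 4), p 0 = v ∧ p 2 = a ∧ p 3 = b := by decide

namespace OEdge

variable {N : ℕ}

@[ext]
theorem ext' {e e' : OEdge N} (h1 : e.tet = e'.tet) (h2 : e.src = e'.src) (h3 : e.dst = e'.dst) :
    e = e' := by
  cases e; cases e'; simp only at h1 h2 h3; subst h1 h2 h3; rfl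

/-- An oriented edge as a tetrahedron and a pair of distinct vertices. -/
def equivProd (N : ℕ) : OEdge N ≃ Fin N × {p : Fin 4 × Fin 4 // p.1 ≠ p.2} where
  toFun e := (e.tet, ⟨(e.src, e.dst), e.ne⟩)
  invFun x := ⟨x.1, x.2.1.1, x.2.1.2, x.2.2⟩
  left_inv _ := rfl
  right_inv _ := rfl

instance : Fintype (OEdge N) := Fintype.ofEquiv _ (equivProd N).symm

instance : DecidableEq (OEdge N) := (equivProd N).decidableEq

theorem card_eq : Fintype.card (OEdge N) = 12 * N := by
  rw [Fintype.card_congr (equivProd N), Fintype.card_prod, Fintype.card_fin, mul_comm]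
  congr 1

theorem rev_rev (e : OEdge N) : e.rev.rev = e := rfl

/-- Reversal of the orientation as a permutation. -/
def revEquiv (N : ℕ) : Equiv.Perm (OEdge N) := ⟨rev, rev, rev_rev, rev_rev⟩

theorem cross_rev (T : IdealTriangulation N) (f : Fin 4) (e : OEdge N) :
    cross T f e.rev = (cross T f e).rev := rfl

/-- The next corner of the triangle at the initial vertex. -/
def rotate (N : ℕ) : Equiv.Perm (OEdge N) where
  toFun e := ⟨e.tet, e.src, nextVertex e.src e.dst, nextVertex_ne _ _ e.ne⟩
  invFun e := ⟨e.tet, e.src, nextVertex e.src (nextVertex e.src e.dst),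
    nextVertex_ne _ _ (nextVertex_ne _ _ e.ne)⟩
  left_inv _ := OEdge.ext' rfl rfl (nextVertex_three _ _)
  right_inv _ := OEdge.ext' rfl rfl (nextVertex_three _ _)

theorem rotate_three (e : OEdge N) : rotate N (rotate N (rotate N e)) = e :=
  OEdge.ext' rfl rfl (nextVertex_three _ _)

theorem rotate_ne (e : OEdge N) : rotate N e ≠ e := fun h =>
  nextVertex_ne_self _ _ e.ne (congrArg OEdge.dst h)

/-- The side of the neighbouring triangle that is glued to the side opposite to a corner. -/
def glueSide (T : IdealTriangulation N) : Equiv.Perm (OEdge N) :=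
  Function.Involutive.toPerm (fun e => cross T e.dst e) fun e => by
    refine OEdge.ext' (T.nbr_nbr _ _) ?_ ?_
    · simp [cross, T.glue_glue]
    · simp [cross, T.glue_glue]

theorem glueSide_glueSide (T : IdealTriangulation N) (e : OEdge N) : glueSide T (glueSide T e) = e :=
  Function.Involutive.toPerm_involutive _ e

theorem glueSide_ne (T : IdealTriangulation N) (e : OEdge N) : glueSide T e ≠ e := fun h =>
  T.no_self e.tet e.dst ⟨congrArg OEdge.tet h, congrArg OEdge.dst h⟩

theorem rotate_rotate_glueSide (T : IdealTriangulation N) (e : OEdge N) :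
    rotate N (rotate N (glueSide T e)) = cross T e.dst (rotate N e) :=
  OEdge.ext' rfl rfl (nextVertex_perm_of_sign_neg (T.oriented _ _) e.ne)

theorem rotate_glueSide (T : IdealTriangulation N) (e : OEdge N) :
    rotate N (glueSide T e) = cross T e.dst (rotate N (rotate N e)) := by
  refine (rotate N).injective ((rotate N).injective ?_)
  rw [rotate_three]
  refine OEdge.ext' rfl rfl ?_
  refine Eq.trans ?_ (nextVertex_perm_of_sign_neg (T.oriented e.tet e.dst)
    (rotate N (rotate N e)).ne).symm
  exact congrArg (T.glue e.tet e.dst) (nextVertex_three _ _).symm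

/-- The corners of a side of a triangle. -/
theorem exists_eq_rotate (e : OEdge N) {f : Fin 4} (h1 : f ≠ e.src) (h2 : f ≠ e.dst) :
    ∃ x : OEdge N, x.tet = e.tet ∧ x.src = e.src ∧ x.dst = f ∧
      (e = rotate N x ∨ e = rotate N (rotate N x)) := by
  refine ⟨⟨e.tet, e.src, f, h1.symm⟩, rfl, rfl, rfl, ?_⟩
  rcases eq_nextVertex_or e.src e.dst f e.ne h1 h2 with h | h
  · exact Or.inl (OEdge.ext' rfl rfl h)
  · exact Or.inr (OEdge.ext' rfl rfl h)

end OEdge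

namespace IdealTriangulation

open OEdge RibbonGraph

variable {N : ℕ} {T : IdealTriangulation N}

theorem EdgeRel.refl (e : OEdge N) : T.EdgeRel e e := EqvGen.refl _

theorem EdgeRel.symm {e e' : OEdge N} (h : T.EdgeRel e e') : T.EdgeRel e' e := EqvGen.symm _ _ h

theorem EdgeRel.trans {e e' e'' : OEdge N} (h : T.EdgeRel e e') (h' : T.EdgeRel e' e'') :
    T.EdgeRel e e'' := EqvGen.trans _ _ _ h h'

theorem edgeRel_cross (e : OEdge N) {f : Fin 4} (h1 : f ≠ e.src) (h2 : f ≠ e.dst) :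
    T.EdgeRel e (cross T f e) := EqvGen.rel _ _ ⟨f, h1, h2, rfl⟩

theorem EdgeRel.rev {e e' : OEdge N} (h : T.EdgeRel e e') : T.EdgeRel e.rev e'.rev := by
  induction h with
  | rel x y h =>
    obtain ⟨f, h1, h2, rfl⟩ := h
    exact edgeRel_cross x.rev h2 h1
  | refl x => exact EdgeRel.refl _
  | symm x y _ ih => exact ih.symm
  | trans x y z _ _ ih1 ih2 => exact ih1.trans ih2

/-- An edge is not identified with itself with the reversed orientation if there is a Ptolemy
assignment. -/
theorem PtolemyAssignment.not_edgeRel_rev {σ : T.SignCocycle} (c : T.PtolemyAssignment σ)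
    {e e' : OEdge N} (h : T.EdgeRel e e') : ¬ T.EdgeRel e.rev e' := fun h' => by
  have h1 := c.glue_eq _ _ (h'.trans h.symm)
  rw [c.val_rev] at h1
  exact c.ne_zero e (by linear_combination -h1 / 2)

theorem mem_vertexFunctions_iff {v : OEdge N → ℂ} :
    v ∈ vertexFunctions (rotate N) (glueSide T) ↔ ∀ e e', T.EdgeRel e e' → v e = v e' := by
  constructor
  · intro hv e e' h
    induction h with
    | rel x y h =>
      obtain ⟨f, h1, h2, rfl⟩ := h
      obtain ⟨w, -, -, rfl, rfl | rfl⟩ := exists_eq_rotate x h1 h2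
      · rw [← rotate_rotate_glueSide, hv w]
      · have := hv (glueSide T w)
        rw [glueSide_glueSide] at this
        rw [← rotate_glueSide, this]
    | refl x => rfl
    | symm x y _ ih => exact ih.symm
    | trans x y z _ _ ih1 ih2 => exact ih1.trans ih2
  · intro hv x
    rw [rotate_rotate_glueSide]
    exact (hv _ _ (edgeRel_cross (rotate N x) x.ne.symm (nextVertex_ne_self _ _ x.ne).symm)).symm

/-- A function on the corners is a potential if its increments across a side do not depend on the
corner. -/
theorem bdry_glueSide_of_cross {R : Type*} [AddCommGroup R] {s : Fin N → Fin 4 → Fin 4 → R}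
    {h : OEdge N → R}
    (hs : ∀ e f, f ≠ e.src → f ≠ e.dst → h (cross T f e) = h e + s e.tet e.src f) (x : OEdge N) :
    bdry (rotate N) h (glueSide T x) = - bdry (rotate N) h x := by
  simp only [bdry]
  rw [rotate_rotate_glueSide, rotate_glueSide, hs, hs]
  · change _ + s x.tet x.src x.dst - (_ + s x.tet x.src x.dst) = _
    abel
  · exact x.ne.symm
  · exact (nextVertex_ne_self _ _ x.ne).symm
  · exact x.ne.symm
  · intro h
    have h2 : nextVertex x.src (nextVertex x.src x.dst) = x.dst := h.symm
    have h3 := nextVertex_three x.src x.dst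
    rw [h2] at h3
    exact nextVertex_ne_self _ _ x.ne h3

theorem constant_of_invariant {f : OEdge N → ℂ} (hρ : f ∈ invariants (rotate N))
    (hτ : f ∈ invariants (glueSide T)) (x y : OEdge N) : f x = f y := by
  have hsrc : ∀ e e' : OEdge N, e.tet = e'.tet → e.src = e'.src → f e = f e' := by
    intro e e' h1 h2
    by_cases h3 : e'.dst = e.dst
    · rw [OEdge.ext' h1 h2 h3.symm]
    · obtain ⟨w, hw1, hw2, hw3, hw⟩ := exists_eq_rotate e (f := e'.dst) (h2 ▸ e'.ne.symm) h3
      have : w = e' := OEdge.ext' (hw1.trans h1) (hw2.trans h2) hw3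
      subst this
      rcases hw with rfl | rfl
      · exact hρ w
      · exact (hρ _).trans (hρ w)
  have hother : ∀ v : Fin 4, v ≠ nextVertex v (v + 1) := by decide
  let F : Fin N × Fin 4 → ℂ := fun a => f ⟨a.1, a.2, _, hother a.2⟩
  have hF : ∀ e : OEdge N, f e = F (e.tet, e.src) := fun e => hsrc _ _ rfl rfl
  have hrel : ∀ a b, EqvGen (fun x y : Fin N × Fin 4 =>
      ∃ f, f ≠ x.2 ∧ y = (T.nbr x.1 f, T.glue x.1 f x.2)) a b → F a = F b := by
    intro a b h
    induction h with
    | rel a b h =>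
      obtain ⟨g, hg, rfl⟩ := h
      have h1 := hF (glueSide T ⟨a.1, a.2, g, hg.symm⟩)
      rw [hτ, hF] at h1
      exact h1
    | refl a => rfl
    | symm a b _ ih => exact ih.symm
    | trans a b c _ _ ih1 ih2 => exact ih1.trans ih2
  rw [hF, hF y]
  exact hrel _ _ (T.one_cusp _ _)

/-- The index of an edge. -/
noncomputable def EdgeIndexing.index (E : T.EdgeIndexing) (e : OEdge N) : Fin N :=
  (E.existsUnique e).choose

theorem EdgeIndexing.edgeRel_index (E : T.EdgeIndexing) (e : OEdge N) :
    T.EdgeRel e (E.edge (E.index e)) ∨ T.EdgeRel e.rev (E.edge (E.index e)) :=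
  (E.existsUnique e).choose_spec.1

theorem EdgeIndexing.index_eq (E : T.EdgeIndexing) {e : OEdge N} {i : Fin N}
    (h : T.EdgeRel e (E.edge i) ∨ T.EdgeRel e.rev (E.edge i)) : E.index e = i :=
  ((E.existsUnique e).choose_spec.2 i h).symm

theorem EdgeIndexing.index_eq_iff (E : T.EdgeIndexing) {e : OEdge N} {i : Fin N} :
    E.index e = i ↔ T.EdgeRel e (E.edge i) ∨ T.EdgeRel e.rev (E.edge i) :=
  ⟨fun h => h ▸ E.edgeRel_index e, E.index_eq⟩

theorem finrank_invariants_rotate :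
    4 * N ≤ Module.finrank ℂ (invariants (rotate N)) := by
  let π : OEdge N → Fin N × Fin 4 := fun e => (e.tet, e.src)
  have hπ : Function.Surjective π := fun a =>
    ⟨⟨a.1, a.2, a.2 + 1, by have : ∀ v : Fin 4, v ≠ v + 1 := by decide
                            exact this _⟩, rfl⟩
  let g := (LinearMap.funLeft ℂ ℂ π).codRestrict (invariants (rotate N)) fun f x => rfl
  have hg : Function.Injective g := fun a b h =>
    LinearMap.funLeft_injective_of_surjective ℂ ℂ π hπ (congrArg Subtype.val h)
  have := LinearMap.finrank_le_finrank_of_injective hg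
  rw [Module.finrank_fintype_fun_eq_card, Fintype.card_prod, Fintype.card_fin,
    Fintype.card_fin] at this
  omega

theorem finrank_vertexFunctions (E : T.EdgeIndexing)
    (hrev : ∀ e e', T.EdgeRel e e' → ¬ T.EdgeRel e.rev e') :
    2 * N ≤ Module.finrank ℂ (vertexFunctions (rotate N) (glueSide T)) := by
  classical
  let π : OEdge N → Fin N × Bool := fun e =>
    (E.index e, decide (T.EdgeRel e (E.edge (E.index e))))
  have hinv : ∀ e e', T.EdgeRel e e' → π e = π e' := by
    intro e e' h
    have h1 : E.index e = E.index e' := E.index_eq <| by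
      rcases E.edgeRel_index e' with h' | h'
      · exact Or.inl (h.trans h')
      · exact Or.inr (h.rev.trans h')
    refine Prod.ext h1 ?_
    simp only [π, h1, decide_eq_decide]
    exact ⟨fun h' => h.symm.trans h', fun h' => h.trans h'⟩
  have hπ : Function.Surjective π := by
    rintro ⟨i, b⟩
    cases b
    · have h1 : E.index (E.edge i).rev = i := E.index_eq (Or.inr (EdgeRel.refl _))
      refine ⟨(E.edge i).rev, Prod.ext h1 ?_⟩
      simp only [π, h1, decide_eq_false_iff_not]
      exact hrev _ _ (EdgeRel.refl _)
    · have h1 : E.index (E.edge i) = i := E.index_eq (Or.inl (EdgeRel.refl _))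
      refine ⟨E.edge i, Prod.ext h1 ?_⟩
      simp only [π, h1, decide_eq_true_eq]
      exact EdgeRel.refl _
  let g := (LinearMap.funLeft ℂ ℂ π).codRestrict (vertexFunctions (rotate N) (glueSide T))
    fun f => mem_vertexFunctions_iff.2 fun e e' h => congrArg f (hinv e e' h)
  have hg : Function.Injective g := fun a b h =>
    LinearMap.funLeft_injective_of_surjective ℂ ℂ π hπ (congrArg Subtype.val h)
  have := LinearMap.finrank_le_finrank_of_injective hg
  rw [Module.finrank_fintype_fun_eq_card, Fintype.card_prod, Fintype.card_fin,
    Fintype.card_bool] at this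
  omega

/-! ### Potentials of cocycles -/

theorem LiftRel.translate {u : Fin N → Fin 4 → Fin 4 → ℤ} {x y : ℤ × OEdge N}
    (h : T.LiftRel u x y) (k : ℤ) : T.LiftRel u (x.1 + k, x.2) (y.1 + k, y.2) := by
  induction h with
  | rel x y h =>
    obtain ⟨f, h1, h2, rfl⟩ := h
    refine EqvGen.rel _ _ ⟨f, h1, h2, ?_⟩
    simp only [add_right_comm]
  | refl x => exact EqvGen.refl _
  | symm x y _ ih => exact EqvGen.symm _ _ ih
  | trans x y z _ _ ih1 ih2 => exact EqvGen.trans _ _ _ ih1 ih2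

theorem LiftRel.edgeRel {u : Fin N → Fin 4 → Fin 4 → ℤ} {x y : ℤ × OEdge N}
    (h : T.LiftRel u x y) : T.EdgeRel x.2 y.2 := by
  induction h with
  | rel x y h =>
    obtain ⟨f, h1, h2, rfl⟩ := h
    exact edgeRel_cross _ h1 h2
  | refl x => exact EdgeRel.refl _
  | symm x y _ ih => exact ih.symm
  | trans x y z _ _ ih1 ih2 => exact ih1.trans ih2

theorem liftRel_cross {u : Fin N → Fin 4 → Fin 4 → ℤ} (k : ℤ) (e : OEdge N) {f : Fin 4}
    (h1 : f ≠ e.src) (h2 : f ≠ e.dst) :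
    T.LiftRel u (k, e) (k + u e.tet e.src f, cross T f e) := EqvGen.rel _ _ ⟨f, h1, h2, rfl⟩

theorem EdgeRel.exists_liftRel (u : Fin N → Fin 4 → Fin 4 → ℤ) {e e' : OEdge N}
    (h : T.EdgeRel e e') : ∃ k, T.LiftRel u (0, e) (k, e') := by
  induction h with
  | rel x y h =>
    obtain ⟨f, h1, h2, rfl⟩ := h
    exact ⟨_, liftRel_cross 0 x h1 h2⟩
  | refl x => exact ⟨0, EqvGen.refl _⟩
  | symm x y _ ih =>
    obtain ⟨k, hk⟩ := ih
    refine ⟨-k, ?_⟩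
    have := LiftRel.translate (EqvGen.symm _ _ hk) (-k)
    simpa using this
  | trans x y z _ _ ih1 ih2 =>
    obtain ⟨k, hk⟩ := ih1
    obtain ⟨l, hl⟩ := ih2
    refine ⟨l + k, EqvGen.trans _ _ _ hk ?_⟩
    have := LiftRel.translate hl k
    rwa [zero_add] at this

/-- A cocycle without monodromy around the edges has a potential on the corners. -/
theorem exists_potential {u : Fin N → Fin 4 → Fin 4 → ℤ}
    (hu : ∀ (e : OEdge N) (k l : ℤ), T.LiftRel u (k, e) (l, e) → k = l) :
    ∃ h : OEdge N → ℤ, ∀ e f, f ≠ e.src → f ≠ e.dst →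
      h (cross T f e) = h e + u e.tet e.src f := by
  let S : Setoid (OEdge N) := EqvGen.setoid fun e e' =>
    ∃ f, f ≠ e.src ∧ f ≠ e.dst ∧ e' = OEdge.cross T f e
  let r : OEdge N → OEdge N := fun e => (Quotient.mk S e).out
  have hr : ∀ e, T.EdgeRel e (r e) := fun e => EdgeRel.symm (Quotient.mk_out (s := S) e)
  choose h hh using fun e => (hr e).exists_liftRel u
  refine ⟨fun e => - h e, fun e f h1 h2 => ?_⟩
  have hreq : r (cross T f e) = r e :=
    congrArg Quotient.out (Quotient.sound (s := S) (edgeRel_cross e h1 h2)).symm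
  have h3 := liftRel_cross (T := T) (u := u) 0 e h1 h2
  have h4 := LiftRel.translate (hh (cross T f e)) (u e.tet e.src f)
  rw [hreq] at h4
  have h5 : T.LiftRel u (h e, r e) (h (cross T f e) + u e.tet e.src f, r e) :=
    EqvGen.trans _ _ _ (EqvGen.symm _ _ (hh e)) (EqvGen.trans _ _ _ h3 h4)
  have := hu _ _ _ h5
  simp only
  omega

/-! ### Peripheral paths -/

namespace PeripheralPath

/-- A peripheral path as a path in the ribbon graph. -/
def toClosedPath (γ : T.PeripheralPath) : ClosedPath (rotate N) (glueSide T) where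
  n := γ.n
  entry i := ⟨(γ.turn i).1, (γ.turn i).2 0, (γ.turn i).2 2, (γ.turn i).2.injective.ne (by decide)⟩
  exit i := ⟨(γ.turn i).1, (γ.turn i).2 0, (γ.turn i).2 3, (γ.turn i).2.injective.ne (by decide)⟩
  turn i := by
    rcases Int.units_eq_one_or (Equiv.Perm.sign (γ.turn i).2) with h | h
    · exact Or.inl (OEdge.ext' rfl rfl (nextVertex_of_sign_one _ h).1)
    · exact Or.inr (OEdge.ext' rfl rfl (nextVertex_of_sign_neg_one _ h).1)
  step i := OEdge.ext' (γ.closed i).1 (γ.closed i).2.1 (γ.closed i).2.2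

/-- The corner around which a peripheral path turns. -/
def corner (γ : T.PeripheralPath) (i : Fin (γ.n + 1)) : OEdge N :=
  ⟨(γ.turn i).1, (γ.turn i).2 0, (γ.turn i).2 1, (γ.turn i).2.injective.ne (by decide)⟩

theorem turning_toClosedPath (γ : T.PeripheralPath) (e : OEdge N) :
    γ.toClosedPath.turning e
      = ∑ i, if γ.corner i = e then (Equiv.Perm.sign (γ.turn i).2 : ℤ) else 0 := by
  refine Finset.sum_congr rfl fun i _ => ?_
  rcases Int.units_eq_one_or (Equiv.Perm.sign (γ.turn i).2) with h | h
  · have h1 : γ.toClosedPath.exit i = rotate N (γ.toClosedPath.entry i) :=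
      OEdge.ext' rfl rfl (nextVertex_of_sign_one _ h).1
    have h2 : rotate N (rotate N (γ.toClosedPath.entry i)) = γ.corner i :=
      OEdge.ext' rfl rfl (nextVertex_of_sign_one _ h).2.symm
    rw [if_pos h1, h2, h]; rfl
  · have h1 : γ.toClosedPath.exit i = rotate N (rotate N (γ.toClosedPath.entry i)) :=
      OEdge.ext' rfl rfl (nextVertex_of_sign_neg_one _ h).1
    have h2 : rotate N (γ.toClosedPath.entry i) = γ.corner i :=
      OEdge.ext' rfl rfl (nextVertex_of_sign_neg_one _ h).2.symm
    rw [if_neg (by rw [h1]; exact rotate_ne _), h2, h]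
    split_ifs <;> simp

theorem increment_toClosedPath (γ : T.PeripheralPath) {s : Fin N → Fin 4 → Fin 4 → ℤ}
    {h : OEdge N → ℤ}
    (hs : ∀ e f, f ≠ e.src → f ≠ e.dst → h (cross T f e) = h e + s e.tet e.src f) :
    γ.toClosedPath.increment h = ∑ i, s (γ.turn i).1 ((γ.turn i).2 0) ((γ.turn i).2 3) := by
  refine Finset.sum_congr rfl fun i _ => ?_
  rw [rotate_rotate_glueSide, hs]
  · rw [add_sub_cancel_left]; rfl
  · exact (γ.toClosedPath.exit i).ne.symm
  · exact (nextVertex_ne_self _ _ (γ.toClosedPath.exit i).ne).symm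

theorem exists_toClosedPath_eq (δ : ClosedPath (rotate N) (glueSide T)) :
    ∃ γ : T.PeripheralPath, γ.toClosedPath = δ := by
  have hex : ∀ i, (δ.exit i).tet = (δ.entry i).tet ∧ (δ.exit i).src = (δ.entry i).src ∧
      (δ.entry i).dst ≠ (δ.exit i).dst := by
    intro i
    rcases δ.turn i with h | h
    · rw [h]; exact ⟨rfl, rfl, (nextVertex_ne_self _ _ (δ.entry i).ne).symm⟩
    · rw [h]
      refine ⟨rfl, rfl, fun h' => ?_⟩
      have h3 := nextVertex_three (δ.entry i).src (δ.entry i).dst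
      have h4 : (δ.entry i).dst
        = nextVertex (δ.entry i).src (nextVertex (δ.entry i).src (δ.entry i).dst) := h'
      rw [← h4] at h3
      exact nextVertex_ne_self _ _ (δ.entry i).ne h3
  choose p hp using fun i => exists_perm_of_ne (δ.entry i).src (δ.entry i).dst (δ.exit i).dst
    (δ.entry i).ne ((hex i).2.1 ▸ (δ.exit i).ne) (hex i).2.2
  refine ⟨⟨δ.n, fun i => ((δ.entry i).tet, p i), fun i => ?_⟩, ?_⟩
  · simp only [hp, δ.step]
    refine ⟨?_, ?_, ?_⟩
    · change T.nbr (δ.exit i).tet _ = _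
      rw [(hex i).1]
    · change T.glue (δ.exit i).tet _ (δ.exit i).src = _
      rw [(hex i).1, (hex i).2.1]
    · change T.glue (δ.exit i).tet _ _ = _
      rw [(hex i).1]
  · obtain ⟨n, a, b, ht, hs⟩ := δ
    have ha : (fun i => (⟨(a i).tet, p i 0, p i 2, (p i).injective.ne (by decide)⟩ : OEdge N)) = a :=
      funext fun i => OEdge.ext' rfl (hp i).1 (hp i).2.1
    have hb : (fun i => (⟨(a i).tet, p i 0, p i 3, (p i).injective.ne (by decide)⟩ : OEdge N)) = b :=
      funext fun i => OEdge.ext' (hex i).1.symm ((hp i).1.trans (hex i).2.1.symm) (hp i).2.2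
    unfold toClosedPath
    congr 1

end PeripheralPath

/-- The potential of the infinite cyclic cover is, up to vertex functions and functions on the
triangles, the turning number of `m · λ`. -/
theorem exists_bdry_potential_eq (E : T.EdgeIndexing)
    (hrev : ∀ e e', T.EdgeRel e e' → ¬ T.EdgeRel e.rev e') (A : T.CyclicCover)
    (lam : T.PeripheralPath) (hlam : lam.IsPeripheralCurve) (hA : A.alpha lam = 0) (m : ℕ)
    (hm : AddSubgroup.closure (Set.range A.alpha) = AddSubgroup.zmultiples (m : ℤ))
    {h : OEdge N → ℤ}
    (hh : ∀ e f, f ≠ e.src → f ≠ e.dst → h (cross T f e) = h e + A.shift e.tet f) :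
    ∃ a : ℂ, (a = m ∨ a = - m) ∧ ∃ v ∈ vertexFunctions (rotate N) (glueSide T),
      ∀ x, bdry (rotate N) (fun y => (h y : ℂ)) x
        = a * lam.toClosedPath.flux x + bdry (rotate N) v x := by
  obtain ⟨u, hu⟩ := hlam
  obtain ⟨g, hg⟩ := exists_potential u.closed
  have hα : ∀ γ : T.PeripheralPath, γ.toClosedPath.increment h = A.alpha γ := fun γ =>
    γ.increment_toClosedPath (s := fun j _ f => A.shift j f) hh
  refine exists_bdry_eq_natCast_mul_flux_add rotate_three rotate_ne (glueSide_glueSide T) (glueSide_ne T)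
    (fun f => constant_of_invariant) ?_ lam.toClosedPath (bdry_glueSide_of_cross hg)
    (bdry_glueSide_of_cross (s := fun j _ f => A.shift j f) hh) ?_ ?_ m ?_
  · have h1 := finrank_invariants_rotate (N := N)
    have h2 := finrank_vertexFunctions E hrev
    have h3 := OEdge.card_eq (N := N)
    omega
  · rw [lam.increment_toClosedPath hg, hu]
  · rw [hα, hA]
  · rw [← hm]
    congr 1
    ext y
    constructor
    · rintro ⟨δ, rfl⟩
      obtain ⟨γ, rfl⟩ := PeripheralPath.exists_toClosedPath_eq δ
      exact ⟨γ, (hα γ).symm⟩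
    · rintro ⟨γ, rfl⟩
      exact ⟨γ.toClosedPath, hα γ⟩

end IdealTriangulation

namespace IdealTriangulation

open OEdge RibbonGraph

variable {N : ℕ} {T : IdealTriangulation N}

/-! ### Logarithmic derivatives of the shape parameters -/

/-- The logarithmic derivative `ζ` of the shape parameter at an edge of a tetrahedron. -/
noncomputable def edgeZeta (q : Fin N → ZMod 3) (z : Fin N → ℂ) (e : OEdge N) : ℂ :=
  zetaParam (quadOf e.src e.dst - q e.tet) (z e.tet)

theorem quadOf_comm : ∀ v w, quadOf v w = quadOf w v := by decide

theorem quadOf_nextVertex : ∀ v w, v ≠ w → quadOf v (nextVertex v w) = quadOf v w - 1 := by decide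

theorem edgeZeta_rev (q : Fin N → ZMod 3) (z : Fin N → ℂ) (e : OEdge N) :
    edgeZeta q z e.rev = edgeZeta q z e := by
  unfold edgeZeta
  rw [quadOf_comm]; rfl

theorem zetaParam_zero (z : ℂ) : zetaParam 0 z = 1 / z := rfl

theorem zetaParam_one (z : ℂ) : zetaParam 1 z = 1 / (1 - z) := by
  simp [zetaParam]

theorem zetaParam_two (z : ℂ) : zetaParam 2 z = 1 / (z * (z - 1)) := by
  have h1 : (2 : ZMod 3) ≠ 0 := by decide
  have h2 : (2 : ZMod 3) ≠ 1 := by decide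
  simp [zetaParam, h1, h2]

theorem zetaParam_ne_zero (s : ZMod 3) {z : ℂ} (h0 : z ≠ 0) (h1 : z ≠ 1) : zetaParam s z ≠ 0 := by
  have h2 : 1 - z ≠ 0 := sub_ne_zero.2 h1.symm
  have h3 : z - 1 ≠ 0 := sub_ne_zero.2 h1
  unfold zetaParam
  split_ifs <;> simp [h0, h2, h3]

theorem zetaParam_sum (s : ZMod 3) {z : ℂ} (h0 : z ≠ 0) (h1 : z ≠ 1) :
    zetaParam s z + zetaParam (s - 1) z + zetaParam (s - 1 - 1) z = 0 := by
  have h2 : 1 - z ≠ 0 := sub_ne_zero.2 h1.symm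
  have h3 : z - 1 ≠ 0 := sub_ne_zero.2 h1
  have key : zetaParam 0 z + zetaParam 1 z + zetaParam 2 z = 0 := by
    rw [zetaParam_zero, zetaParam_one, zetaParam_two, ← neg_sub z 1]
    field_simp
    ring
  have hs : ∀ s : ZMod 3, s = 0 ∨ s = 1 ∨ s = 2 := by decide
  have e1 : (0 - 1 : ZMod 3) = 2 := by decide
  have e2 : (2 - 1 : ZMod 3) = 1 := by decide
  have e3 : (1 - 1 : ZMod 3) = 0 := by decide
  rcases hs s with rfl | rfl | rfl
  · rw [e1, e2]; linear_combination key
  · rw [e3, e1]; linear_combination key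
  · rw [e2, e3]; linear_combination key

theorem edgeZeta_rotate {q : Fin N → ZMod 3} {z : Fin N → ℂ} (h0 : ∀ j, z j ≠ 0)
    (h1 : ∀ j, z j ≠ 1) (e : OEdge N) :
    edgeZeta q z e + edgeZeta q z (rotate N e) + edgeZeta q z (rotate N (rotate N e)) = 0 := by
  have := zetaParam_sum (quadOf e.src e.dst - q e.tet) (h0 e.tet) (h1 e.tet)
  have e1 : quadOf (rotate N e).src (rotate N e).dst = quadOf e.src e.dst - 1 :=
    quadOf_nextVertex _ _ e.ne
  have e2 : quadOf (rotate N (rotate N e)).src (rotate N (rotate N e)).dst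
      = quadOf (rotate N e).src (rotate N e).dst - 1 :=
    quadOf_nextVertex _ _ (rotate N e).ne
  unfold edgeZeta
  rw [e2, e1, sub_right_comm _ 1, sub_right_comm _ 1, sub_right_comm _ 1]
  exact this

/-- The row vector of a weight function on the corners. -/
noncomputable def weightRow (q : Fin N → ZMod 3) (z : Fin N → ℂ) (h : OEdge N → ℂ) (j : Fin N) : ℂ :=
  ∑ e : OEdge N, if e.tet = j then h e * edgeZeta q z e else 0

theorem weightRow_add (q : Fin N → ZMod 3) (z : Fin N → ℂ) (h h' : OEdge N → ℂ) :
    weightRow q z (h + h') = weightRow q z h + weightRow q z h' := by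
  funext j
  simp only [weightRow, Pi.add_apply, ← Finset.sum_add_distrib]
  exact Finset.sum_congr rfl fun e _ => by split_ifs <;> ring

theorem weightRow_smul (q : Fin N → ZMod 3) (z : Fin N → ℂ) (a : ℂ) (h : OEdge N → ℂ) :
    weightRow q z (a • h) = a • weightRow q z h := by
  funext j
  simp only [weightRow, Pi.smul_apply, smul_eq_mul, Finset.mul_sum]
  exact Finset.sum_congr rfl fun e _ => by split_ifs <;> ring

theorem weightRow_eq_zero {q : Fin N → ZMod 3} {z : Fin N → ℂ} (h0 : ∀ j, z j ≠ 0)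
    (h1 : ∀ j, z j ≠ 1) {h : OEdge N → ℂ} (hh : ∀ x, bdry (rotate N) h x = 0) :
    weightRow q z h = 0 := by
  have hinv : ∀ x, h (rotate N x) = h x := fun x => by
    have := hh (rotate N (rotate N x))
    simp only [bdry, rotate_three] at this
    exact (sub_eq_zero.1 this).symm
  funext j
  have e1 : weightRow q z h j
      = ∑ e : OEdge N, if e.tet = j then h e * edgeZeta q z (rotate N e) else 0 := by
    rw [weightRow, ← Equiv.sum_comp (rotate N)]
    exact Finset.sum_congr rfl fun e _ => by rw [hinv]; rfl
  have e2 : weightRow q z h j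
      = ∑ e : OEdge N, if e.tet = j then h e * edgeZeta q z (rotate N (rotate N e)) else 0 := by
    rw [e1, ← Equiv.sum_comp (rotate N)]
    exact Finset.sum_congr rfl fun e _ => by rw [hinv]; rfl
  have e3 : weightRow q z h j + weightRow q z h j + weightRow q z h j = 0 := by
    nth_rewrite 2 [e1]
    nth_rewrite 2 [e2]
    rw [weightRow, ← Finset.sum_add_distrib, ← Finset.sum_add_distrib]
    refine Finset.sum_eq_zero fun e _ => ?_
    split_ifs
    · rw [← mul_add, ← mul_add, edgeZeta_rotate h0 h1, mul_zero]
    · simp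
  simp only [Pi.zero_apply]
  linear_combination e3 / 3

/-! ### Sums over the edges -/

open Classical in
@[to_additive]
theorem prod_index_eq {M : Type*} [CommMonoid M] (E : T.EdgeIndexing)
    (hrev : ∀ e e', T.EdgeRel e e' → ¬ T.EdgeRel e.rev e') (F : OEdge N → M) (i : Fin N) :
    (∏ e, if E.index e = i then F e else 1)
      = ∏ e, if T.EdgeRel e (E.edge i) then F e * F e.rev else 1 := by
  have h1 : ∀ e, (if E.index e = i then F e else 1)
      = (if T.EdgeRel e (E.edge i) then F e else 1)
        * if T.EdgeRel e.rev (E.edge i) then F e else 1 := by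
    intro e
    by_cases ha : T.EdgeRel e (E.edge i)
    · rw [if_pos (E.index_eq (Or.inl ha)), if_pos ha, if_neg (hrev _ _ ha), mul_one]
    · rw [if_neg ha, one_mul]
      exact if_congr (by rw [E.index_eq_iff]; tauto) rfl rfl
  have h2 : (∏ e, if T.EdgeRel e.rev (E.edge i) then F e else 1)
      = ∏ e, if T.EdgeRel e (E.edge i) then F e.rev else 1 := by
    rw [← Equiv.prod_comp (revEquiv N)]
    rfl
  simp only [h1, Finset.prod_mul_distrib]
  rw [h2, ← Finset.prod_mul_distrib]
  exact Finset.prod_congr rfl fun e _ => by split_ifs <;> simp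

open Classical in
@[to_additive]
theorem prod_eq_prod_edgeRel {M : Type*} [CommMonoid M] (E : T.EdgeIndexing)
    (hrev : ∀ e e', T.EdgeRel e e' → ¬ T.EdgeRel e.rev e') (F : OEdge N → M) :
    ∏ e, F e = ∏ i, ∏ e, if T.EdgeRel e (E.edge i) then F e * F e.rev else 1 := by
  simp only [← prod_index_eq E hrev]
  rw [Finset.prod_comm]
  simp

open Classical in
theorem sum_edgeRel_eq_gluing (E : T.EdgeIndexing) (q : Fin N → ZMod 3) (z : Fin N → ℂ)
    (i j : Fin N) :
    (∑ e : OEdge N, if T.EdgeRel e (E.edge i) then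
        (if e.tet = j then edgeZeta q z e else 0) else 0)
      = ∑ s, (T.gluing E q s i j : ℂ) * zetaParam s (z j) := by
  have h1 : ∀ s, (T.gluing E q s i j : ℂ) * zetaParam s (z j) = ∑ e : OEdge N,
      if e.tet = j ∧ quadOf e.src e.dst - q j = s ∧ T.EdgeRel e (E.edge i)
        then zetaParam s (z j) else 0 := by
    intro s
    rw [← Finset.sum_filter, Finset.sum_const, nsmul_eq_mul, gluing, Nat.card_eq_fintype_card,
      Fintype.card_subtype]
  simp only [h1]
  rw [Finset.sum_comm]
  refine Finset.sum_congr rfl fun e _ => ?_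
  by_cases h2 : e.tet = j
  · subst h2
    by_cases h3 : T.EdgeRel e (E.edge i)
    · simp [h3, edgeZeta]
    · simp [h3]
  · simp [h2]

theorem weightRow_turning (γ : T.PeripheralPath) (q : Fin N → ZMod 3) (z : Fin N → ℂ) (j : Fin N) :
    weightRow q z (fun e => (γ.toClosedPath.turning e : ℂ)) j
      = ∑ s, (completeness γ q s j : ℂ) * zetaParam s (z j) := by
  simp only [weightRow, PeripheralPath.turning_toClosedPath, completeness, Int.cast_sum,
    Finset.sum_mul]
  rw [Finset.sum_comm]
  have h1 : ∀ e : OEdge N, (if e.tet = j then ∑ i, ((if γ.corner i = e then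
      (Equiv.Perm.sign (γ.turn i).2 : ℤ) else 0 : ℤ) : ℂ) * edgeZeta q z e else 0)
      = ∑ i, if γ.corner i = e then (if e.tet = j then
        ((Equiv.Perm.sign (γ.turn i).2 : ℤ) : ℂ) * edgeZeta q z e else 0) else 0 := by
    intro e
    split_ifs with h
    · refine Finset.sum_congr rfl fun i _ => ?_
      split_ifs <;> simp
    · simp
  simp only [h1]
  rw [Finset.sum_comm]
  refine Finset.sum_congr rfl fun i _ => ?_
  rw [Finset.sum_ite_eq]
  simp only [Finset.mem_univ, if_true]
  by_cases h2 : (γ.turn i).1 = j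
  · subst h2
    rw [if_pos (show (γ.corner i).tet = (γ.turn i).1 from rfl)]
    simp [edgeZeta, PeripheralPath.corner]
  · rw [if_neg (show ¬ (γ.corner i).tet = j from h2)]
    simp [h2]

/-- The weight of a vertex function is a combination of the rows of the gluing equations. -/
theorem weightRow_vertexFunction (E : T.EdgeIndexing)
    (hrev : ∀ e e', T.EdgeRel e e' → ¬ T.EdgeRel e.rev e') (q : Fin N → ZMod 3) (z : Fin N → ℂ)
    {v : OEdge N → ℂ} (hv : v ∈ vertexFunctions (rotate N) (glueSide T)) (j : Fin N) :
    weightRow q z v j = ∑ i, (v (E.edge i) + v (E.edge i).rev)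
      * ∑ s, (T.gluing E q s i j : ℂ) * zetaParam s (z j) := by
  classical
  rw [mem_vertexFunctions_iff] at hv
  rw [weightRow, sum_eq_sum_edgeRel E hrev]
  refine Finset.sum_congr rfl fun i _ => ?_
  rw [← sum_edgeRel_eq_gluing, Finset.mul_sum]
  refine Finset.sum_congr rfl fun e _ => ?_
  by_cases h : T.EdgeRel e (E.edge i)
  · rw [if_pos h, if_pos h, hv _ _ h, hv _ _ h.rev, edgeZeta_rev]
    change _ + (if e.tet = j then _ else 0) = _
    split_ifs <;> ring
  · rw [if_neg h, if_neg h, mul_zero]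

/-- A product over the edges of a tetrahedron. -/
@[to_additive]
theorem prod_edges_of_tet {M : Type*} [CommMonoid M] (F : OEdge N → M) (j : Fin N) :
    (∏ e : OEdge N, if e.tet = j then F e else 1)
      = F ⟨j, 0, 1, by decide⟩ * F ⟨j, 0, 2, by decide⟩ * F ⟨j, 0, 3, by decide⟩
        * F ⟨j, 1, 2, by decide⟩ * F ⟨j, 1, 3, by decide⟩ * F ⟨j, 2, 3, by decide⟩
        * (F ⟨j, 1, 0, by decide⟩ * F ⟨j, 2, 0, by decide⟩ * F ⟨j, 3, 0, by decide⟩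
        * F ⟨j, 2, 1, by decide⟩ * F ⟨j, 3, 1, by decide⟩ * F ⟨j, 3, 2, by decide⟩) := by
  rw [← Equiv.prod_comp (equivProd N).symm, Fintype.prod_prod_type]
  have h1 : ∀ (x : Fin N), (∏ y : {p : Fin 4 × Fin 4 // p.1 ≠ p.2},
      if ((equivProd N).symm (x, y)).tet = j then F ((equivProd N).symm (x, y)) else 1)
      = if x = j then ∏ y : {p : Fin 4 × Fin 4 // p.1 ≠ p.2}, F ((equivProd N).symm (x, y))
        else 1 := by
    intro x
    change (∏ y : {p : Fin 4 × Fin 4 // p.1 ≠ p.2},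
      if x = j then F ((equivProd N).symm (x, y)) else 1) = _
    split_ifs <;> simp
  simp only [h1, Finset.prod_ite_eq', Finset.mem_univ, if_true]
  have h2 : ∀ G : {p : Fin 4 × Fin 4 // p.1 ≠ p.2} → M, ∏ y, G y
      = G ⟨(0, 1), by decide⟩ * G ⟨(0, 2), by decide⟩ * G ⟨(0, 3), by decide⟩
        * G ⟨(1, 2), by decide⟩ * G ⟨(1, 3), by decide⟩ * G ⟨(2, 3), by decide⟩
        * (G ⟨(1, 0), by decide⟩ * G ⟨(2, 0), by decide⟩ * G ⟨(3, 0), by decide⟩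
        * G ⟨(2, 1), by decide⟩ * G ⟨(3, 1), by decide⟩ * G ⟨(3, 2), by decide⟩) := by
    intro G
    have hu : (Finset.univ : Finset {p : Fin 4 × Fin 4 // p.1 ≠ p.2})
        = {⟨(0, 1), by decide⟩, ⟨(0, 2), by decide⟩, ⟨(0, 3), by decide⟩, ⟨(1, 2), by decide⟩,
          ⟨(1, 3), by decide⟩, ⟨(2, 3), by decide⟩, ⟨(1, 0), by decide⟩, ⟨(2, 0), by decide⟩,
          ⟨(3, 0), by decide⟩, ⟨(2, 1), by decide⟩, ⟨(3, 1), by decide⟩, ⟨(3, 2), by decide⟩} := by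
      decide
    rw [hu]
    repeat rw [Finset.prod_insert (by decide)]
    rw [Finset.prod_singleton]
    simp only [mul_assoc]
  rw [h2]
  rfl

/-! ### The shapes of a Ptolemy assignment -/

theorem exists_zetaParam_scaling {s : ZMod 3} {z a b d s₁ s₂ : ℂ} (h0 : z ≠ 0) (h1 : z ≠ 1)
    (hs : s₁ * s₁ = 1) (hb : b ≠ 0) (hz : shapeParam s z = - (s₁ * s₂) * (d / b))
    (hp : a - s₁ * b - s₂ * d = 0) :
    ∃ K : ℂ, a = K * zetaParam s z ∧ - (s₂ * d) = K * zetaParam (1 + s) z ∧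
      - (s₁ * b) = K * zetaParam (2 + s) z := by
  have h2 : 1 - z ≠ 0 := sub_ne_zero.2 h1.symm
  have h3 : z - 1 ≠ 0 := sub_ne_zero.2 h1
  have hZ : shapeParam s z * (s₁ * b) = - (s₂ * d) := by
    rw [hz]
    field_simp
    linear_combination (-s₂ * d) * hs
  have hcases : ∀ s : ZMod 3, s = 0 ∨ s = 1 ∨ s = 2 := by decide
  have e1 : (1 + 1 : ZMod 3) = 2 := by decide
  have e2 : (2 + 1 : ZMod 3) = 0 := by decide
  have e3 : (1 + 2 : ZMod 3) = 0 := by decide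
  have e4 : (2 + 2 : ZMod 3) = 1 := by decide
  have d1 : (1 : ZMod 3) ≠ 0 := by decide
  have d2 : (2 : ZMod 3) ≠ 0 := by decide
  have d3 : (2 : ZMod 3) ≠ 1 := by decide
  generalize s₁ * b = b' at *
  generalize s₂ * d = d' at *
  obtain rfl : a = b' + d' := by linear_combination hp
  rcases hcases s with rfl | rfl | rfl
  · have hZ' : z * b' = -d' := by simpa [shapeParam] using hZ
    obtain rfl : d' = - (z * b') := by linear_combination hZ'
    refine ⟨b' * z * (1 - z), ?_⟩
    rw [add_zero, add_zero, zetaParam_zero, zetaParam_one, zetaParam_two, ← neg_sub 1 z]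
    refine ⟨?_, ?_, ?_⟩ <;> field_simp
    all_goals ring
  · have hZ' : 1 / (1 - z) * b' = -d' := by simpa [shapeParam] using hZ
    obtain rfl : b' = - (d' * (1 - z)) := by
      field_simp at hZ'
      linear_combination hZ'
    refine ⟨d' * z * (1 - z), ?_⟩
    rw [e1, e2, zetaParam_zero, zetaParam_one, zetaParam_two, ← neg_sub 1 z]
    refine ⟨?_, ?_, ?_⟩ <;> field_simp
    all_goals ring
  · have hZ' : (1 - 1 / z) * b' = -d' := by simpa [shapeParam, d2, d3] using hZ
    obtain rfl : d' = - ((1 - 1 / z) * b') := by linear_combination hZ'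
    refine ⟨b' * (z - 1), ?_⟩
    rw [e3, e4, zetaParam_zero, zetaParam_one, zetaParam_two, ← neg_sub z 1]
    refine ⟨?_, ?_, ?_⟩ <;> field_simp
    all_goals ring

/-- The logarithmic derivatives of a Ptolemy equation are proportional to the `ζ`-parameters. -/
theorem PtolemyAssignment.exists_scaling {σ : T.SignCocycle} (c : T.PtolemyAssignment σ)
    {q : Fin N → ZMod 3} {z : Fin N → ℂ} (h0 : ∀ j, z j ≠ 0) (h1 : ∀ j, z j ≠ 1)
    (hc : c.CorrespondsTo q z) (j : Fin N) :
    ∃ K : ℂ,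
      c.val ⟨j, 0, 2, by decide⟩ * c.val ⟨j, 1, 3, by decide⟩ = K * zetaParam (0 - q j) (z j) ∧
      - (((σ.coeff₂ j : ℤ) : ℂ) * (c.val ⟨j, 0, 1, by decide⟩ * c.val ⟨j, 2, 3, by decide⟩))
        = K * zetaParam (1 - q j) (z j) ∧
      - (((σ.coeff₁ j : ℤ) : ℂ) * (c.val ⟨j, 0, 3, by decide⟩ * c.val ⟨j, 1, 2, by decide⟩))
        = K * zetaParam (2 - q j) (z j) := by
  have hsign : σ.shapeSign j = σ.coeff₁ j * σ.coeff₂ j := by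
    have h0 := σ.closed j 0
    have h1 := σ.closed j 1
    have h2 := σ.closed j 2
    have h3 := σ.closed j 3
    rw [show Finset.univ.erase (0 : Fin 4) = {1, 2, 3} by decide] at h0
    rw [show Finset.univ.erase (1 : Fin 4) = {0, 2, 3} by decide] at h1
    rw [show Finset.univ.erase (2 : Fin 4) = {0, 1, 3} by decide] at h2
    rw [show Finset.univ.erase (3 : Fin 4) = {0, 1, 2} by decide] at h3
    rw [Finset.prod_insert (by decide), Finset.prod_insert (by decide),
      Finset.prod_singleton] at h0 h1 h2 h3
    have hall : (σ.val j 0 1 * (σ.val j 0 2 * σ.val j 0 3))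
        * (σ.val j 1 0 * (σ.val j 1 2 * σ.val j 1 3))
        * (σ.val j 2 0 * (σ.val j 2 1 * σ.val j 2 3))
        * (σ.val j 3 0 * (σ.val j 3 1 * σ.val j 3 2)) = 1 := by
      rw [h0, h1, h2, h3]; rfl
    simp only [SignCocycle.shapeSign, SignCocycle.coeff₁, SignCocycle.coeff₂, Int.units_div_eq_mul]
    rw [← mul_left_inj (σ.val j 0 2 * σ.val j 2 0 * (σ.val j 3 1 * σ.val j 1 3)),
      Int.units_mul_self, ← hall]
    simp only [mul_comm, mul_left_comm, mul_assoc]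
  have hp := c.ptolemy j
  have hj := hc j
  rw [hsign] at hj
  simp only [ptolemyExpr] at hp
  have n1 := c.ne_zero ⟨j, 0, 3, by decide⟩
  have n2 := c.ne_zero ⟨j, 1, 2, by decide⟩
  have n3 := c.ne_zero ⟨j, 0, 1, by decide⟩
  have n4 := c.ne_zero ⟨j, 2, 3, by decide⟩
  have u1 : ((σ.coeff₁ j : ℤ) : ℂ) * ((σ.coeff₁ j : ℤ) : ℂ) = 1 := by
    rw [← Int.cast_mul, ← Units.val_mul, Int.units_mul_self]; simp
  have nb : c.val ⟨j, 0, 3, by decide⟩ * c.val ⟨j, 1, 2, by decide⟩ ≠ 0 := mul_ne_zero n1 n2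
  rw [show quadOf 1 3 = 0 from rfl] at hj
  have e1 : 1 - q j = 1 + (0 - q j) := by ring
  have e2 : 2 - q j = 2 + (0 - q j) := by ring
  rw [e1, e2]
  exact exists_zetaParam_scaling (h0 j) (h1 j) u1 nb (by rw [hj]; push_cast; ring) hp

end IdealTriangulation

namespace IdealTriangulation

open OEdge RibbonGraph

variable {N : ℕ} {T : IdealTriangulation N}

/-! ### The edges of the fundamental domain -/

namespace DomainEdges

variable {E : T.EdgeIndexing} {A : T.CyclicCover} {L : ℕ} (D : DomainEdges E A L)

/-- The number of the listed edge to which an edge of the fundamental domain is equal. -/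
noncomputable def slot (e : OEdge N) : Fin N ⊕ Fin L := (D.existsUnique e).choose

theorem slot_spec (e : OEdge N) :
    A.Rel (0, e) (0, D.edge (D.slot e)) ∨ A.Rel (0, e.rev) (0, D.edge (D.slot e)) :=
  (D.existsUnique e).choose_spec.1

theorem slot_eq {e : OEdge N} {s : Fin N ⊕ Fin L}
    (h : A.Rel (0, e) (0, D.edge s) ∨ A.Rel (0, e.rev) (0, D.edge s)) : D.slot e = s :=
  ((D.existsUnique e).choose_spec.2 s h).symm

theorem slot_rev (e : OEdge N) : D.slot e.rev = D.slot e :=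
  D.slot_eq (D.slot_spec e).symm

/-- The index of the edge of the triangulation that a listed edge covers. -/
def baseIndex : Fin N ⊕ Fin L → Fin N := Sum.elim id D.src

/-- The power of the deck transformation in a listed edge. -/
def slotLevel : Fin N ⊕ Fin L → ℤ := Sum.elim 0 D.k

theorem rel_base (s : Fin N ⊕ Fin L) :
    A.Rel (0, D.edge s) (D.slotLevel s, D.edge (Sum.inl (D.baseIndex s))) := by
  rcases s with i | l
  · exact EqvGen.refl _
  · exact D.lift_eq l

theorem edgeRel_base (s : Fin N ⊕ Fin L) :
    T.EdgeRel (D.edge s) (E.edge (D.baseIndex s)) :=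
  (LiftRel.edgeRel (D.rel_base s)).trans (D.base _)

theorem index_eq (e : OEdge N) : E.index e = D.baseIndex (D.slot e) := by
  refine E.index_eq ((D.slot_spec e).imp ?_ ?_) <;>
  exact fun h => (LiftRel.edgeRel h).trans (D.edgeRel_base _)

/-- The power of the deck transformation that carries the chosen lift of an edge to the lift in the
fundamental domain. -/
noncomputable def level (e : OEdge N) : ℤ := D.slotLevel (D.slot e)

theorem level_rev (e : OEdge N) : D.level e.rev = D.level e := by
  rw [level, slot_rev]; rfl

theorem rel_level (e : OEdge N) :
    A.Rel (0, e) (D.level e, D.edge (Sum.inl (E.index e))) ∨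
      A.Rel (0, e.rev) (D.level e, D.edge (Sum.inl (E.index e))) := by
  rw [D.index_eq]
  exact (D.slot_spec e).imp (fun h => EqvGen.trans _ _ _ h (D.rel_base _))
    fun h => EqvGen.trans _ _ _ h (D.rel_base _)

theorem level_eq_of_rel (hrev : ∀ e e', T.EdgeRel e e' → ¬ T.EdgeRel e.rev e') {e : OEdge N}
    {k : ℤ} {i : Fin N} (h : A.Rel (0, e) (k, D.edge (Sum.inl i))) : k = D.level e := by
  have hi : E.index e = i := E.index_eq (Or.inl ((LiftRel.edgeRel h).trans (D.base i)))
  rcases D.rel_level e with h' | h'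
  · rw [hi] at h'
    exact A.closed _ _ _ (EqvGen.trans _ _ _ (EqvGen.symm _ _ h) h')
  · rw [hi] at h'
    exact absurd (LiftRel.edgeRel h') (hrev _ _ (LiftRel.edgeRel h))

theorem level_cross (hrev : ∀ e e', T.EdgeRel e e' → ¬ T.EdgeRel e.rev e') (e : OEdge N)
    (f : Fin 4) (h1 : f ≠ e.src) (h2 : f ≠ e.dst) :
    D.level e = D.level (cross T f e) + A.shift e.tet f := by
  have key : ∀ e : OEdge N, f ≠ e.src → f ≠ e.dst →
      A.Rel (0, cross T f e) (D.level (cross T f e), D.edge (Sum.inl (E.index (cross T f e)))) →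
      D.level e = D.level (cross T f e) + A.shift e.tet f := by
    intro e h1 h2 h
    have h3 := LiftRel.translate h (A.shift e.tet f)
    have h4 : A.Rel (0, e) (0 + A.shift e.tet f, cross T f e) :=
      liftRel_cross (u := fun j _ f => A.shift j f) 0 e h1 h2
    exact (D.level_eq_of_rel hrev (EqvGen.trans _ _ _ h4 h3)).symm
  rcases D.rel_level (cross T f e) with h | h
  · exact key e h1 h2 h
  · have hi : E.index (cross T f e).rev = E.index (cross T f e) :=
      E.index_eq (E.edgeRel_index (cross T f e)).symm
    have := key e.rev h2 h1 (by rw [cross_rev, level_rev, hi]; exact h)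
    rw [cross_rev, level_rev, level_rev] at this
    exact this

open Classical in
/-- The sign of an edge with respect to the orientation of the listed edge. -/
noncomputable def sign (e : OEdge N) : ℂ := if A.Rel (0, e) (0, D.edge (D.slot e)) then 1 else -1

open Classical in
theorem var_eq (e : OEdge N) :
    D.var e = MvPolynomial.C (D.sign e) * MvPolynomial.X (D.slot e) := by
  unfold var sign
  change (if A.Rel (0, e) (0, D.edge (D.slot e)) then MvPolynomial.X (D.slot e)
    else - MvPolynomial.X (D.slot e)) = _
  split_ifs <;> simp

variable {σ : T.SignCocycle} (c : T.PtolemyAssignment σ)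

theorem val_edge (s : Fin N ⊕ Fin L) : c.val (D.edge s) = c.val (E.edge (D.baseIndex s)) :=
  c.glue_eq _ _ (D.edgeRel_base s)

theorem val_eq_sign_mul (e : OEdge N) : c.val e = D.sign e * c.val (E.edge (E.index e)) := by
  rw [D.index_eq, ← D.val_edge]
  unfold sign
  split_ifs with h
  · rw [one_mul]; exact c.glue_eq _ _ (LiftRel.edgeRel h)
  · rw [← c.glue_eq _ _ (LiftRel.edgeRel ((D.slot_spec e).resolve_left h)), c.val_rev]
    ring

theorem eval_var (e : OEdge N) :
    MvPolynomial.eval (fun s => c.val (D.edge s)) (D.var e) = c.val e := by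
  rw [var_eq, D.val_eq_sign_mul, D.index_eq, ← D.val_edge]
  simp

theorem eval_pderiv_var (e : OEdge N) (s : Fin N ⊕ Fin L) :
    MvPolynomial.eval (fun s => c.val (D.edge s)) (MvPolynomial.pderiv s (D.var e))
      = if D.slot e = s then D.sign e else 0 := by
  classical
  rw [var_eq]
  simp only [MvPolynomial.pderiv_C_mul, MvPolynomial.pderiv_X, map_mul, MvPolynomial.eval_C,
    Pi.single_apply]
  split_ifs <;> simp_all

/-- The differential of the `σ`-Ptolemy expression at `c` in terms of the differentials of the six
edges. -/
noncomputable def ptolemyDifferential (j : Fin N) (y : OEdge N → ℂ) : ℂ :=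
  (c.val ⟨j, 0, 2, by decide⟩ * y ⟨j, 1, 3, by decide⟩
      + c.val ⟨j, 1, 3, by decide⟩ * y ⟨j, 0, 2, by decide⟩)
    - ((σ.coeff₁ j : ℤ) : ℂ) * (c.val ⟨j, 0, 3, by decide⟩ * y ⟨j, 1, 2, by decide⟩
      + c.val ⟨j, 1, 2, by decide⟩ * y ⟨j, 0, 3, by decide⟩)
    - ((σ.coeff₂ j : ℤ) : ℂ) * (c.val ⟨j, 0, 1, by decide⟩ * y ⟨j, 2, 3, by decide⟩
      + c.val ⟨j, 2, 3, by decide⟩ * y ⟨j, 0, 1, by decide⟩)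

theorem eval_pderiv_poly_inl (t : ℂ) (j : Fin N) (s : Fin N ⊕ Fin L) :
    MvPolynomial.eval (fun s => c.val (D.edge s)) (MvPolynomial.pderiv s (D.poly σ t (Sum.inl j)))
      = ptolemyDifferential c j fun e => if D.slot e = s then D.sign e else 0 := by
  simp only [poly, ptolemyExpr, ptolemyDifferential, map_sub, Derivation.leibniz, smul_eq_mul,
    map_add, map_mul, eval_var, eval_pderiv_var, Derivation.map_intCast, mul_zero, add_zero,
    map_intCast]

theorem eval_pderiv_poly_inr (t : ℂ) (l : Fin L) (s : Fin N ⊕ Fin L) :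
    MvPolynomial.eval (fun s => c.val (D.edge s)) (MvPolynomial.pderiv s (D.poly σ t (Sum.inr l)))
      = (if Sum.inr l = s then 1 else 0)
        - t ^ (- D.k l) * (if Sum.inl (D.src l) = s then 1 else 0) := by
  classical
  simp only [poly, map_sub, MvPolynomial.pderiv_C_mul, MvPolynomial.pderiv_X, map_mul,
    MvPolynomial.eval_C, Pi.single_apply]
  congr 2 <;> split_ifs <;> simp_all

theorem ptolemyDifferential_sum {ι : Type*} (S : Finset ι) (j : Fin N) (y : ι → OEdge N → ℂ)
    (w : ι → ℂ) :
    ∑ s ∈ S, ptolemyDifferential c j (y s) * w s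
      = ptolemyDifferential c j fun e => ∑ s ∈ S, y s e * w s := by
  classical
  induction S using Finset.induction_on with
  | empty => simp [ptolemyDifferential]
  | insert a S ha ih =>
    simp only [Finset.sum_insert ha]
    rw [ih]
    simp only [ptolemyDifferential]
    ring

/-- Elimination of the variables of the edges that are not chosen lifts. -/
theorem jacobianDet_eq (t : ℂ) :
    D.jacobianDet c t = Matrix.det (Matrix.of fun j i : Fin N => ptolemyDifferential c j fun e =>
      if E.index e = i then D.sign e * t ^ (- D.level e) else 0) := by
  have hblock : (Matrix.of fun r s : Fin N ⊕ Fin L => MvPolynomial.eval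
        (fun s => c.val (D.edge s)) (MvPolynomial.pderiv s (D.poly σ t r)))
      = Matrix.fromBlocks
        (Matrix.of fun j i => ptolemyDifferential c j
          fun e => if D.slot e = Sum.inl i then D.sign e else 0)
        (Matrix.of fun j l => ptolemyDifferential c j
          fun e => if D.slot e = Sum.inr l then D.sign e else 0)
        (Matrix.of fun l i => - (t ^ (- D.k l) * if D.src l = i then 1 else 0)) 1 := by
    ext r s
    rcases r with j | l <;> rcases s with i | l' <;>
    simp [eval_pderiv_poly_inl, eval_pderiv_poly_inr, Matrix.one_apply]
  rw [jacobianDet, hblock, Matrix.det_fromBlocks_one₂₂]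
  congr 1
  ext j i
  rw [Matrix.sub_apply, Matrix.mul_apply]
  simp only [Matrix.of_apply]
  rw [ptolemyDifferential_sum]
  have hsub : ∀ y y' : OEdge N → ℂ, ptolemyDifferential c j y - ptolemyDifferential c j y'
      = ptolemyDifferential c j fun e => y e - y' e := fun y y' => by
    simp only [ptolemyDifferential]; ring
  rw [hsub]
  congr 1
  funext e
  rw [D.index_eq, level]
  generalize D.sign e = ε
  rcases D.slot e with i' | l
  · simp [baseIndex, slotLevel]
  · simp only [reduceCtorEq, if_false, Sum.inr.injEq, baseIndex, slotLevel, Sum.elim_inr, zero_sub]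
    rw [Finset.sum_eq_single l]
    · simp
    · intro l' _ h; rw [if_neg h.symm, zero_mul]
    · intro h; exact absurd (Finset.mem_univ _) h

variable (q : Fin N → ZMod 3) (z : Fin N → ℂ)

/-- The gluing matrix twisted by the infinite cyclic cover. -/
noncomputable def twistedGluing (t : ℂ) : Matrix (Fin N) (Fin N) ℂ :=
  Matrix.of fun i j => (1 / 2) * ∑ e : OEdge N,
    if e.tet = j then (if E.index e = i then edgeZeta q z e * t ^ (- D.level e) else 0) else 0

theorem prod_mul_jacobianDet {q : Fin N → ZMod 3} {z : Fin N → ℂ} {K : Fin N → ℂ}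
    (hK : ∀ j, c.val ⟨j, 0, 2, by decide⟩ * c.val ⟨j, 1, 3, by decide⟩
        = K j * zetaParam (0 - q j) (z j) ∧
      - (((σ.coeff₂ j : ℤ) : ℂ) * (c.val ⟨j, 0, 1, by decide⟩ * c.val ⟨j, 2, 3, by decide⟩))
        = K j * zetaParam (1 - q j) (z j) ∧
      - (((σ.coeff₁ j : ℤ) : ℂ) * (c.val ⟨j, 0, 3, by decide⟩ * c.val ⟨j, 1, 2, by decide⟩))
        = K j * zetaParam (2 - q j) (z j)) (t : ℂ) :
    (∏ i, c.val (E.edge i)) * D.jacobianDet c t = (∏ j, K j) * (D.twistedGluing q z t).det := by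
  rw [jacobianDet_eq, ← Matrix.det_mul_row, ← Matrix.det_transpose (D.twistedGluing q z t),
    ← Matrix.det_mul_column]
  congr 1
  ext j i
  simp only [Matrix.of_apply, Matrix.transpose_apply, twistedGluing]
  obtain ⟨y, hy⟩ : ∃ y : OEdge N → ℂ, ∀ e, y e = if E.index e = i then t ^ (- D.level e) else 0 :=
    ⟨_, fun _ => rfl⟩
  have hz : ∀ e : OEdge N, (if E.index e = i then edgeZeta q z e * t ^ (- D.level e) else 0)
      = edgeZeta q z e * y e := by
    intro e; rw [hy]; split_ifs <;> simp
  have hyr : ∀ e, y e.rev = y e := by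
    intro e
    have hi : E.index e.rev = E.index e := E.index_eq (E.edgeRel_index e).symm
    rw [hy, hy, hi, level_rev]
  have hsc : ∀ e : OEdge N, c.val (E.edge i) *
      (if E.index e = i then D.sign e * t ^ (- D.level e) else 0) = c.val e * y e := by
    intro e
    rw [hy]
    split_ifs with h
    · rw [D.val_eq_sign_mul c e, h]; ring
    · simp
  have hlin : ∀ y : OEdge N → ℂ, c.val (E.edge i) * ptolemyDifferential c j y
      = ptolemyDifferential c j fun e => c.val (E.edge i) * y e := fun y => by
    simp only [ptolemyDifferential]; ring
  have hedge : ∀ a b h, edgeZeta q z ⟨j, a, b, h⟩ = zetaParam (quadOf a b - q j) (z j) :=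
    fun _ _ _ => rfl
  simp only [hz]
  have hback : ∀ a b h, edgeZeta q z ⟨j, b, a, Ne.symm h⟩ * y ⟨j, b, a, Ne.symm h⟩
      = edgeZeta q z ⟨j, a, b, h⟩ * y ⟨j, a, b, h⟩ := fun a b h => by
    rw [← edgeZeta_rev, ← hyr]; rfl
  rw [hlin, sum_edges_of_tet (fun e => edgeZeta q z e * y e)]
  simp only [hback 0 1 (by decide), hback 0 2 (by decide), hback 0 3 (by decide),
    hback 1 2 (by decide), hback 1 3 (by decide), hback 2 3 (by decide)]
  simp only [hsc, ptolemyDifferential, hedge]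
  rw [show quadOf 0 1 = 1 from rfl, show quadOf 0 2 = 0 from rfl, show quadOf 0 3 = 2 from rfl,
    show quadOf 1 2 = 2 from rfl, show quadOf 1 3 = 0 from rfl, show quadOf 2 3 = 1 from rfl]
  obtain ⟨k0, k1, k2⟩ := hK j
  linear_combination (y ⟨j, 0, 2, by decide⟩ + y ⟨j, 1, 3, by decide⟩) * k0
    + (y ⟨j, 0, 1, by decide⟩ + y ⟨j, 2, 3, by decide⟩) * k1
    + (y ⟨j, 0, 3, by decide⟩ + y ⟨j, 1, 2, by decide⟩) * k2

end DomainEdges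

end IdealTriangulation

/-! ### Derivatives of determinants -/

theorem differentiableAt_det {n : ℕ} {M : ℂ → Matrix (Fin n) (Fin n) ℂ} {t₀ : ℂ}
    (hM : ∀ i j, DifferentiableAt ℂ (fun t => M t i j) t₀) :
    DifferentiableAt ℂ (fun t => (M t).det) t₀ := by
  simp only [Matrix.det_apply]
  exact DifferentiableAt.fun_sum fun s _ =>
    (DifferentiableAt.fun_finsetProd fun i _ => hM (s i) i).const_smul _

/-- The derivative of the determinant of a family of matrices at a point where the sum of the rows
vanishes. -/
theorem hasDerivAt_det_of_sum_rows_eq_zero {n : ℕ} {M : ℂ → Matrix (Fin n) (Fin n) ℂ} {t₀ : ℂ}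
    {S : Fin n → ℂ} (hM : ∀ i j, DifferentiableAt ℂ (fun t => M t i j) t₀)
    (hS : ∀ j, HasDerivAt (fun t => ∑ i, M t i j) (S j) t₀) (h0 : ∀ j, ∑ i, M t₀ i j = 0)
    (r : Fin n) : HasDerivAt (fun t => (M t).det) ((M t₀).updateRow r S).det t₀ := by
  have hexp : ∀ (A : Matrix (Fin n) (Fin n) ℂ) (v : Fin n → ℂ),
      (A.updateRow r v).det = ∑ j, A.transpose.adjugate r j * v j := fun A v => by
    rw [← Matrix.cramer_transpose_apply, Matrix.cramer_eq_adjugate_mulVec]; rfl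
  have hdet : ∀ t, (M t).det = ∑ j, (M t).transpose.adjugate r j * ∑ i, M t i j := fun t => by
    have h1 := Matrix.det_updateRow_sum (M t) r 1
    rw [Pi.one_apply, one_smul] at h1
    rw [← h1, hexp]
    refine Finset.sum_congr rfl fun j _ => ?_
    simp only [Pi.one_apply, one_smul]
    exact congrArg _ (Finset.sum_apply _ _ _)
  simp only [hdet]
  rw [hexp]
  refine HasDerivAt.fun_sum fun j _ => ?_
  have hadj : DifferentiableAt ℂ (fun t => (M t).transpose.adjugate r j) t₀ := by
    simp only [Matrix.adjugate_apply]
    refine differentiableAt_det fun i k => ?_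
    simp only [Matrix.updateRow_apply]
    split_ifs
    · exact differentiableAt_const _
    · exact hM k i
  have := hadj.hasDerivAt.mul (hS j)
  rwa [h0, mul_zero, zero_add] at this

namespace IdealTriangulation

open OEdge RibbonGraph

variable {N : ℕ} {T : IdealTriangulation N}

namespace DomainEdges

variable {E : T.EdgeIndexing} {A : T.CyclicCover} {L : ℕ} (D : DomainEdges E A L)
  (q : Fin N → ZMod 3) (z : Fin N → ℂ)

theorem sum_twistedGluing (t : ℂ) (j : Fin N) :
    ∑ i, D.twistedGluing q z t i j
      = (1 / 2) * ∑ e : OEdge N, if e.tet = j then edgeZeta q z e * t ^ (- D.level e) else 0 := by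
  simp only [twistedGluing, Matrix.of_apply, ← Finset.mul_sum]
  rw [Finset.sum_comm]
  congr 1
  refine Finset.sum_congr rfl fun e _ => ?_
  split_ifs <;> simp

theorem twistedGluing_one (hrev : ∀ e e', T.EdgeRel e e' → ¬ T.EdgeRel e.rev e') (i j : Fin N) :
    D.twistedGluing q z 1 i j = ∑ s, (T.gluing E q s i j : ℂ) * zetaParam s (z j) := by
  classical
  simp only [twistedGluing, Matrix.of_apply, one_zpow, mul_one]
  rw [← sum_edgeRel_eq_gluing]
  have h1 : ∀ e : OEdge N, (if e.tet = j then (if E.index e = i then edgeZeta q z e else 0) else 0)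
      = if E.index e = i then (if e.tet = j then edgeZeta q z e else 0) else 0 := fun e => by
    split_ifs <;> rfl
  simp only [h1]
  rw [sum_index_eq E hrev, Finset.mul_sum]
  refine Finset.sum_congr rfl fun e _ => ?_
  rw [edgeZeta_rev]
  simp only [show e.rev.tet = e.tet from rfl]
  split_ifs <;> ring

variable {q z}

/-- The derivative of the twisted gluing determinant. -/
theorem hasDerivAt_det_twistedGluing (h0 : ∀ j, z j ≠ 0) (h1 : ∀ j, z j ≠ 1) (r : Fin N) :
    HasDerivAt (fun t => (D.twistedGluing q z t).det)
      ((D.twistedGluing q z 1).updateRow r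
        ((1 / 2 : ℂ) • weightRow q z fun e => ((- D.level e : ℤ) : ℂ))).det 1 := by
  have hpow : ∀ k : ℤ, HasDerivAt (fun t : ℂ => t ^ k) k 1 := fun k => by
    simpa using hasDerivAt_zpow k (1 : ℂ) (Or.inl one_ne_zero)
  refine hasDerivAt_det_of_sum_rows_eq_zero (fun i j => ?_) (fun j => ?_) (fun j => ?_) r
  · simp only [twistedGluing, Matrix.of_apply]
    refine DifferentiableAt.const_mul (DifferentiableAt.fun_sum fun e _ => ?_) _
    split_ifs
    · exact (hpow _).differentiableAt.const_mul _
    · exact differentiableAt_const _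
    · exact differentiableAt_const _
  · simp only [sum_twistedGluing, Pi.smul_apply, smul_eq_mul, weightRow]
    refine HasDerivAt.const_mul _ (HasDerivAt.fun_sum fun e _ => ?_)
    split_ifs
    · rw [mul_comm]
      exact (hpow _).const_mul _
    · exact hasDerivAt_const _ _
  · have := congrFun (weightRow_eq_zero (q := q) h0 h1 (h := fun _ => 1) (by simp [bdry])) j
    simp only [weightRow, one_mul, Pi.zero_apply] at this
    simp [sum_twistedGluing, this]

/-- The derivative of the twisted gluing determinant in terms of a peripheral curve on which `α`
vanishes. -/
theorem exists_hasDerivAt_det_twistedGluing (h0 : ∀ j, z j ≠ 0) (h1 : ∀ j, z j ≠ 1)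
    (hrev : ∀ e e', T.EdgeRel e e' → ¬ T.EdgeRel e.rev e')
    (lam : T.PeripheralPath) (hlam : lam.IsPeripheralCurve) (hA : A.alpha lam = 0) (m : ℕ)
    (hm : AddSubgroup.closure (Set.range A.alpha) = AddSubgroup.zmultiples (m : ℤ)) (r : Fin N) :
    ∃ a : ℂ, (a = m ∨ a = - m) ∧ HasDerivAt (fun t => (D.twistedGluing q z t).det)
      (a * ((1 / 2) * Matrix.det (Matrix.of fun i j : Fin N =>
      ∑ s : ZMod 3, (if i = r then (completeness lam q s j : ℂ) else (T.gluing E q s i j : ℂ))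
        * zetaParam s (z j)))) 1 := by
  obtain ⟨a, ha, v, hv, hav⟩ := exists_bdry_potential_eq E hrev A lam hlam hA m hm
    (h := fun e => - D.level e) fun e f h1 h2 => by
      rw [D.level_cross hrev e f h1 h2]; ring
  refine ⟨a, ha, ?_⟩
  convert D.hasDerivAt_det_twistedGluing h0 h1 r using 1
  set G := D.twistedGluing q z 1
  set τ : OEdge N → ℂ := fun e => lam.toClosedPath.turning e
  set α : OEdge N → ℂ := fun e => ((- D.level e : ℤ) : ℂ)
  have hα : weightRow q z α = a • weightRow q z τ + weightRow q z v := by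
    have : weightRow q z (α + ((-a) • τ + (-1 : ℂ) • v)) = 0 := by
      refine weightRow_eq_zero h0 h1 fun x => ?_
      have e1 := hav x
      have e2 : bdry (rotate N) τ x = lam.toClosedPath.flux x := by
        rw [bdry_intCast, ClosedPath.bdry_turning rotate_three rotate_ne]
      rw [← e2] at e1
      change bdry (rotate N) α x = _ at e1
      simp only [bdry, Pi.add_apply, Pi.smul_apply, smul_eq_mul] at e1 ⊢
      linear_combination e1
    rw [weightRow_add, weightRow_add, weightRow_smul, weightRow_smul] at this
    rw [← sub_eq_zero, ← this]
    funext j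
    simp only [Pi.add_apply, Pi.sub_apply, Pi.smul_apply, smul_eq_mul]
    ring
  have hvrow : weightRow q z v = ∑ i, (v (E.edge i) + v (E.edge i).rev) • G i := by
    funext j
    rw [weightRow_vertexFunction E hrev q z hv]
    simp [G, D.twistedGluing_one q z hrev]
  have hdetG : G.det = 0 := by
    have h2 := Matrix.det_updateRow_sum G r 1
    rw [Pi.one_apply, one_smul] at h2
    rw [← h2]
    refine Matrix.det_eq_zero_of_row_eq_zero r fun j => ?_
    rw [Matrix.updateRow_self]
    have := congrFun (weightRow_eq_zero (q := q) h0 h1 (h := fun _ => 1) (by simp [bdry])) j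
    simp only [weightRow, one_mul, Pi.zero_apply] at this
    have h3 := D.sum_twistedGluing q z 1 j
    simp only [one_zpow, mul_one] at h3
    rw [this, mul_zero] at h3
    simp only [Pi.one_apply, one_smul]
    exact (Finset.sum_apply _ _ _).trans h3
  have hrow : (G.updateRow r (weightRow q z v)).det = 0 := by
    rw [hvrow, Matrix.det_updateRow_sum, hdetG, smul_zero]
  have hmat : (Matrix.of fun i j : Fin N =>
      ∑ s : ZMod 3, (if i = r then (completeness lam q s j : ℂ) else (T.gluing E q s i j : ℂ))
        * zetaParam s (z j)) = G.updateRow r (weightRow q z τ) := by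
    ext i j
    rw [Matrix.updateRow_apply, Matrix.of_apply]
    split_ifs with hi
    · exact (weightRow_turning lam q z j).symm
    · exact (D.twistedGluing_one q z hrev i j).symm
  rw [hmat, Matrix.det_updateRow_smul, hα, Matrix.det_updateRow_add, Matrix.det_updateRow_smul,
    hrow]
  ring

end DomainEdges

/-! ### The normalization by the flattening -/

open Classical in
theorem PtolemyAssignment.prod_val_eq {σ : T.SignCocycle} (c : T.PtolemyAssignment σ)
    (E : T.EdgeIndexing) (q : Fin N → ZMod 3) (s : ZMod 3) (j : Fin N) :
    (∏ e : OEdge N, if e.tet = j ∧ quadOf e.src e.dst - q j = s then c.val e else 1)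
      = ∏ i, (- c.val (E.edge i) ^ 2) ^ T.gluing E q s i j := by
  rw [prod_eq_prod_edgeRel E (fun e e' => c.not_edgeRel_rev)]
  refine Finset.prod_congr rfl fun i _ => ?_
  rw [gluing, Nat.card_eq_fintype_card, Fintype.card_subtype, ← Finset.prod_const,
    Finset.prod_filter]
  refine Finset.prod_congr rfl fun e _ => ?_
  have hq : quadOf e.rev.src e.rev.dst = quadOf e.src e.dst := quadOf_comm _ _
  rw [hq]
  simp only [show e.rev.tet = e.tet from rfl]
  by_cases h : T.EdgeRel e (E.edge i)
  · rw [c.val_rev, c.glue_eq _ _ h]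
    simp only [h, if_true, and_true]
    split_ifs <;> ring
  · simp [h]

theorem sq_scaling_mul_zeta {σ : T.SignCocycle} (c : T.PtolemyAssignment σ)
    {q : Fin N → ZMod 3} {z : Fin N → ℂ} {K : ℂ} {j : Fin N}
    (hK : c.val ⟨j, 0, 2, by decide⟩ * c.val ⟨j, 1, 3, by decide⟩
        = K * zetaParam (0 - q j) (z j) ∧
      - (((σ.coeff₂ j : ℤ) : ℂ) * (c.val ⟨j, 0, 1, by decide⟩ * c.val ⟨j, 2, 3, by decide⟩))
        = K * zetaParam (1 - q j) (z j) ∧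
      - (((σ.coeff₁ j : ℤ) : ℂ) * (c.val ⟨j, 0, 3, by decide⟩ * c.val ⟨j, 1, 2, by decide⟩))
        = K * zetaParam (2 - q j) (z j)) (s : ZMod 3) :
    (K * zetaParam s (z j)) ^ 2
      = ∏ e : OEdge N, if e.tet = j ∧ quadOf e.src e.dst - q j = s then c.val e else 1 := by
  simp only [ite_and]
  rw [prod_edges_of_tet]
  have hval : ∀ a b h, c.val ⟨j, b, a, Ne.symm h⟩ = - c.val ⟨j, a, b, h⟩ := fun a b h =>
    c.val_rev ⟨j, a, b, h⟩
  simp only [hval 0 1 (by decide), hval 0 2 (by decide), hval 0 3 (by decide),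
    hval 1 2 (by decide), hval 1 3 (by decide), hval 2 3 (by decide)]
  rw [show quadOf 0 1 = 1 from rfl, show quadOf 0 2 = 0 from rfl, show quadOf 0 3 = 2 from rfl,
    show quadOf 1 2 = 2 from rfl, show quadOf 1 3 = 0 from rfl, show quadOf 2 3 = 1 from rfl,
    show quadOf 1 0 = 1 from rfl, show quadOf 2 0 = 0 from rfl, show quadOf 3 0 = 2 from rfl,
    show quadOf 2 1 = 2 from rfl, show quadOf 3 1 = 0 from rfl, show quadOf 3 2 = 1 from rfl]
  obtain ⟨k0, k1, k2⟩ := hK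
  have hs : s = 0 - q j ∨ s = 1 - q j ∨ s = 2 - q j := by
    have : ∀ s t : ZMod 3, s = 0 - t ∨ s = 1 - t ∨ s = 2 - t := by decide
    exact this _ _
  have hsq : ∀ u : ℤˣ, ((u : ℤ) : ℂ) ^ 2 = 1 := fun u => by
    rw [sq, ← Int.cast_mul, ← Units.val_mul, Int.units_mul_self]; simp
  have d1 : (1 : ZMod 3) ≠ 0 := by decide
  have d2 : (2 : ZMod 3) ≠ 0 := by decide
  have d3 : (2 : ZMod 3) ≠ 1 := by decide
  rcases hs with rfl | rfl | rfl
  · simp only [sub_left_inj, if_true, if_neg d1, if_neg d2]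
    rw [← k0]; ring
  · simp only [sub_left_inj, if_true, if_neg d1.symm, if_neg d3]
    rw [← k1, neg_sq, mul_pow, hsq]; ring
  · simp only [sub_left_inj, if_true, if_neg d2.symm, if_neg d3.symm]
    rw [← k2, neg_sq, mul_pow, hsq]; ring

theorem prod_zpow_eq_zpow_sum {ι : Type*} (S : Finset ι) {a : ℂ} (ha : a ≠ 0) (f : ι → ℤ) :
    ∏ s ∈ S, a ^ f s = a ^ ∑ s ∈ S, f s := by
  classical
  induction S using Finset.induction_on with
  | empty => simp
  | insert s S hs ih => rw [Finset.prod_insert hs, Finset.sum_insert hs, ih, zpow_add₀ ha]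

theorem sq_prod_scaling {σ : T.SignCocycle} (c : T.PtolemyAssignment σ) (E : T.EdgeIndexing)
    {q : Fin N → ZMod 3} {z K : Fin N → ℂ} (hK0 : ∀ j, K j ≠ 0)
    (hK : ∀ j s, (K j * zetaParam s (z j)) ^ 2 = ∏ i, (- c.val (E.edge i) ^ 2) ^ T.gluing E q s i j)
    {f : ZMod 3 → Fin N → ℤ} (hf : T.IsFlattening E q f) :
    ((∏ j, K j) * ∏ j, ∏ s : ZMod 3, zetaParam s (z j) ^ f s j) ^ 2
      = ((∏ i, c.val (E.edge i)) ^ 2) ^ 2 := by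
  have hne : ∀ i, - c.val (E.edge i) ^ 2 ≠ 0 := fun i => neg_ne_zero.2 (pow_ne_zero 2 (c.ne_zero _))
  have e1 : ∀ j, K j * ∏ s : ZMod 3, zetaParam s (z j) ^ f s j
      = ∏ s : ZMod 3, (K j * zetaParam s (z j)) ^ f s j := fun j => by
    simp only [mul_zpow, Finset.prod_mul_distrib]
    rw [prod_zpow_eq_zpow_sum _ (hK0 j), hf.sum_eq, zpow_one]
  have e2 : ∀ j s, ((K j * zetaParam s (z j)) ^ f s j) ^ 2
      = ∏ i, (- c.val (E.edge i) ^ 2) ^ ((T.gluing E q s i j : ℤ) * f s j) := fun j s => by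
    rw [← zpow_natCast, ← zpow_mul, mul_comm (f s j), zpow_mul, zpow_natCast, hK,
      ← Finset.prod_zpow]
    exact Finset.prod_congr rfl fun i _ => by rw [zpow_mul, zpow_natCast]
  rw [← Finset.prod_mul_distrib]
  simp only [e1, ← Finset.prod_pow, e2]
  rw [Finset.prod_congr rfl fun j _ => Finset.prod_comm, Finset.prod_comm]
  refine Finset.prod_congr rfl fun i _ => ?_
  rw [Finset.prod_comm]
  simp only [prod_zpow_eq_zpow_sum _ (hne i)]
  rw [hf.gluing_eq i]
  norm_cast
  ring

end IdealTriangulation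

theorem corollary3p5 {N : ℕ} (T : IdealTriangulation N) (E : T.EdgeIndexing)
    (q : Fin N → ZMod 3) (z : Fin N → ℂ) (hz : T.IsSolution E q z)
    (σ : T.SignCocycle) (c : T.PtolemyAssignment σ) (hc : c.CorrespondsTo q z)
    (A : T.CyclicCover) {L : ℕ} (D : IdealTriangulation.DomainEdges E A L)
    (lam : T.PeripheralPath) (hlam : lam.IsPeripheralCurve) (hA : A.alpha lam = 0)
    (m : ℕ) (hm : AddSubgroup.closure (Set.range A.alpha) = AddSubgroup.zmultiples (m : ℤ))
    (f : ZMod 3 → Fin N → ℤ) (hf : T.IsFlattening E q f) (r : Fin N) :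
    ∃ d : ℂ, HasDerivAt (D.jacobianDet c) d 1 ∧
      ((m : ℂ) * T.oneLoop E q z lam f r = 1 / (∏ i, c.val (E.edge i)) * d ∨
        (m : ℂ) * T.oneLoop E q z lam f r = - (1 / (∏ i, c.val (E.edge i)) * d)) := by
  have h0 := hz.ne_zero
  have h1 := hz.ne_one
  choose K hK using c.exists_scaling h0 h1 hc
  obtain ⟨a, ha, hderiv⟩ := D.exists_hasDerivAt_det_twistedGluing (q := q) h0 h1
    (fun e e' => c.not_edgeRel_rev) lam hlam hA m hm r
  have hC : ∏ i, c.val (E.edge i) ≠ 0 := Finset.prod_ne_zero_iff.2 fun i _ => c.ne_zero _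
  have hP : ∏ j, ∏ s : ZMod 3, zetaParam s (z j) ^ f s j ≠ 0 :=
    Finset.prod_ne_zero_iff.2 fun j _ => Finset.prod_ne_zero_iff.2 fun s _ =>
      zpow_ne_zero _ (IdealTriangulation.zetaParam_ne_zero s (h0 j) (h1 j))
  have hK0 : ∀ j, K j ≠ 0 := fun j h => by
    have := (hK j).1
    rw [h, zero_mul] at this
    exact mul_ne_zero (c.ne_zero _) (c.ne_zero _) this
  have hsq := IdealTriangulation.sq_prod_scaling c E hK0 (fun j s =>
    (IdealTriangulation.sq_scaling_mul_zeta c (hK j) s).trans (c.prod_val_eq E q s j)) hf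
  have hjac : D.jacobianDet c = fun t =>
      (∏ j, K j) / (∏ i, c.val (E.edge i)) * (D.twistedGluing q z t).det := by
    funext t
    have := D.prod_mul_jacobianDet c hK t
    field_simp
    linear_combination this
  refine ⟨_, hjac ▸ hderiv.const_mul _, ?_⟩
  unfold IdealTriangulation.oneLoop
  generalize Matrix.det (_ : Matrix (Fin N) (Fin N) ℂ) = δ
  generalize ∏ j, ∏ s : ZMod 3, zetaParam s (z j) ^ f s j = P at *
  generalize ∏ i, c.val (E.edge i) = C at *
  generalize ∏ j, K j = Q at *
  rcases ha with rfl | rfl <;> rcases sq_eq_sq_iff_eq_or_eq_neg.1 hsq with h | h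
  · left; field_simp; linear_combination (-m * δ) * h
  · right; field_simp; linear_combination (m * δ) * h
  · right; field_simp; linear_combination (-m * δ) * h
  · left; field_simp; linear_combination (m * δ) * h
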